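/- Let $\ell>0$, $T>0$, $h>0$, $\theta>0$, $\Omega_T=(0,\ell)\times(0,T)$, and let $\rho_A,\mu,r,\kappa\in L^\infty(0,\ell)$ satisfy, for a.e. $x\in(0,\ell)$, $$0<\rho_0\le\rho_A(x)\le\rho_1,\quad 0\le\mu_0\le\mu(x)\le\mu_1,\quad 0<r_0\le r(x)\le r_1,\quad 0<\kappa_0\le\kappa(x)\le\kappa_1 .$$ Let $g\in H^1(0,T)$ with $g(0)=0$, and put $M(t)=\frac{2h\cos\theta}{\pi}\,g(t)$. Let $u=u(x,t;g)$ be the weak solution of $$\rho_A(x)u_{tt}+\mu(x)u_t+\big(r(x)u_{xx}+\kappa(x)u_{xxt}\big)_{xx}=0\ \text{ in }\Omega_T,\qquad u(x,0)=u_t(x,0)=0,$$ $$u(0,t)=u_x(0,t)=0,\qquad \big(r u_{xx}+\kappa u_{xxt}\big)(\ell,t)=M(t),\qquad -\big(r u_{xx}+\kappa u_{xxt}\big)_x(\ell,t)=g(t).$$ Here, with $\mathcal V^2(0,\ell)=\{v\in H^2(0,\ell): v(0)=v'(0)=0\}$, a weak solution is a function $u\in L^2(0,T;\mathcal V^2(0,\ell))$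 with $u_t\in L^2(0,T;L^2(0,\ell))$ and $u(\cdot,0)=0$ such that, for all $v\in\mathcal V^2(0,\ell)$ and all smooth $\varphi$ on $[0,T]$ that vanish near $T$, $$\int_0^T\!\!\int_0^\ell\big[-\rho_A u_t v\varphi'+\mu u_t v\varphi+r u_{xx}v''\varphi-\kappa u_{xx}v''\varphi'\big]\,dx\,dt=\int_0^T\big[g(t)v(\ell)+M(t)v'(\ell)\big]\varphi(t)\,dt .$$ Then the output (tip displacement) $t\mapsto u(\ell,t;g)$ belongs to $H^1(0,T)$ and satisfies $$\|u(\ell,\cdot;g)\|_{H^1(0,T)}^2\le C_3^2\,\|g'\|_{L^2(0,T)}^2,\qquad C_3^2=\frac{\ell^3}{3}\Big(C_1^2+\frac{r_0}{4\kappa_0}C_2^2\Big),$$ where $\|y\|^2_{H^1(0,T)}=\|y\|^2_{L^2(0,T)}+\|y'\|^2_{L^2(0,T)}$ and $$C_1^2=C_0^2(1+C_\theta^2)e^T,\quad C_2^2=C_0^2(1+C_\theta^2)(1+e^T),\quad C_0^2=\frac{4\hat\ell(1+T)}{r_0^2},\quad C_\theta^2=\Big(\frac{2h\cos\theta}{\pi}\Big)^2,\quad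 \hat\ell=\ell+\frac{\ell^3}{3}.$$ -/

import Mathlib

open MeasureTheory Set
open scoped ContDiff

noncomputable section

namespace AFMBeam

/-! ### Sobolev spaces on a bounded interval, through weak derivatives -/

/-- `f'` is the weak derivative of `f` on the open interval `(a, b)`. -/
structure HasWeakDerivOn (a b : ℝ) (f f' : ℝ → ℝ) : Prop where
  locInt : LocallyIntegrableOn f (Ioo a b)
  locInt' : LocallyIntegrableOn f' (Ioo a b)
  integral_eq : ∀ φ : ℝ → ℝ, ContDiff ℝ ∞ φ → HasCompactSupport φ → tsupport φ ⊆ Ioo a b →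
    ∫ x in Ioo a b, f x * deriv φ x = -∫ x in Ioo a b, f' x * φ x

/-- Membership in `L²(a, b)`. -/
def MemL2 (a b : ℝ) (f : ℝ → ℝ) : Prop :=
  MemLp f 2 (volume.restrict (Ioo a b))

/-- Membership in the Sobolev space `H¹(a, b)` (a property of the a.e. class of `f`). -/
def MemH1 (a b : ℝ) (f : ℝ → ℝ) : Prop :=
  MemL2 a b f ∧ ∃ f' : ℝ → ℝ, MemL2 a b f' ∧ HasWeakDerivOn a b f f'

open Classical in
/-- A choice of the (a.e. unique) weak derivative of `f` on `(a, b)`; the zero function if there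
is none. -/
def weakDeriv (a b : ℝ) (f : ℝ → ℝ) : ℝ → ℝ :=
  if h : ∃ f' : ℝ → ℝ, HasWeakDerivOn a b f f' then h.choose else 0

/-- The squared norm of `L²(a, b)`. -/
def l2NormSq (a b : ℝ) (f : ℝ → ℝ) : ℝ :=
  ∫ x in Ioo a b, f x ^ 2

/-- The squared norm of `H¹(a, b)`. -/
def h1NormSq (a b : ℝ) (f : ℝ → ℝ) : ℝ :=
  l2NormSq a b f + l2NormSq a b (weakDeriv a b f)

/-- `v` belongs to the space `𝒱²(0, ℓ) = {v ∈ H²(0, ℓ) : v(0) = v'(0) = 0}`, with first and second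
derivatives `v₁` and `v₂`. As usual, `v` and `v₁` are the continuous representatives on `[0, ℓ]`,
so that `v 0`, `v₁ 0`, `v ℓ`, `v₁ ℓ` are the boundary values (and `v`, `v₁` are in `L²(0, ℓ)`). -/
structure MemV2 (ℓ : ℝ) (v v₁ v₂ : ℝ → ℝ) : Prop where
  cont : ContinuousOn v (Icc 0 ℓ)
  cont₁ : ContinuousOn v₁ (Icc 0 ℓ)
  deriv₁ : HasWeakDerivOn 0 ℓ v v₁
  deriv₂ : HasWeakDerivOn 0 ℓ v₁ v₂
  memL2 : MemL2 0 ℓ v₂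
  clamped : v 0 = 0
  clamped₁ : v₁ 0 = 0

/-! ### The beam problem -/

/-- The space-time domain `Ω_T = (0, ℓ) × (0, T)`. -/
def Omega (ℓ T : ℝ) : Set (ℝ × ℝ) := Ioo 0 ℓ ×ˢ Ioo 0 T

/-- Membership in `L²(Ω_T) = L²(0, T; L²(0, ℓ))`. -/
def MemL2Omega (ℓ T : ℝ) (w : ℝ → ℝ → ℝ) : Prop :=
  MemLp (fun p : ℝ × ℝ => w p.1 p.2) 2 (volume.restrict (Omega ℓ T))

/-- Test functions in time: smooth functions on `[0, T]` that vanish near `t = T`, but not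
necessarily at `t = 0`. -/
structure IsTimeTest (T : ℝ) (φ : ℝ → ℝ) : Prop where
  smooth : ContDiff ℝ ∞ φ
  compact : HasCompactSupport φ
  supp : tsupport φ ⊆ Iio T

/-- `c ∈ L^∞(0, ℓ)` with `lo ≤ c ≤ hi` (almost everywhere) in `(0, ℓ)`. -/
def IsCoeff (ℓ lo hi : ℝ) (c : ℝ → ℝ) : Prop :=
  MemLp c ⊤ (volume.restrict (Ioo 0 ℓ)) ∧
    ∀ᵐ x ∂(volume.restrict (Ioo 0 ℓ)), lo ≤ c x ∧ c x ≤ hi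

/-- `u = u(x, t)` is a weak solution on `(0, ℓ) × (0, T)` of
`ρ u_tt + μ u_t + (r u_xx + κ u_xxt)_xx = 0`, `u(x, 0) = u_t(x, 0) = 0`,
`u(0, t) = u_x(0, t) = 0`, `(r u_xx + κ u_xxt)(ℓ, t) = M(t)`,
`-(r u_xx + κ u_xxt)_x(ℓ, t) = g(t)`.

The class is `u ∈ L²(0, T; 𝒱²(0, ℓ))`, `u_t ∈ L²(0, T; L²(0, ℓ))`. The equation is multiplied by
`v(x) φ(t)` and integrated by parts, twice in space (this gives the two Neumann data) and once in
time, in the terms with `u_tt` and `u_xxt`. The initial conditions are imposed by letting `φ` be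
nonzero at `t = 0`: there are no boundary terms at `t = 0`. -/
def IsWeakSolution (ℓ T : ℝ) (ρ μ r κ M g : ℝ → ℝ) (u : ℝ → ℝ → ℝ) : Prop :=
  ∃ ux uxx ut : ℝ → ℝ → ℝ,
    -- `u ∈ L²(0, T; 𝒱²(0, ℓ))`
    MemL2Omega ℓ T u ∧ MemL2Omega ℓ T ux ∧ MemL2Omega ℓ T uxx ∧
    (∀ᵐ t ∂(volume.restrict (Ioo 0 T)),
      MemV2 ℓ (fun x => u x t) (fun x => ux x t) (fun x => uxx x t)) ∧
    -- `ut ∈ L²(0, T; L²(0, ℓ))` is the weak time derivative of `u`, and `u(x, 0) = 0`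
    MemL2Omega ℓ T ut ∧
    (∀ ψ φ : ℝ → ℝ, ContDiff ℝ ∞ ψ → HasCompactSupport ψ → tsupport ψ ⊆ Ioo 0 ℓ →
      IsTimeTest T φ →
      ∫ p in Omega ℓ T, u p.1 p.2 * (ψ p.1 * deriv φ p.2) =
        -∫ p in Omega ℓ T, ut p.1 p.2 * (ψ p.1 * φ p.2)) ∧
    -- the equation, the conditions at `x = ℓ`, and `u_t(x, 0) = 0`
    (∀ v v₁ v₂ φ : ℝ → ℝ, MemV2 ℓ v v₁ v₂ → IsTimeTest T φ →
      ∫ p in Omega ℓ T,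
          (-(ρ p.1 * ut p.1 p.2 * v p.1 * deriv φ p.2)
            + μ p.1 * ut p.1 p.2 * v p.1 * φ p.2
            + r p.1 * uxx p.1 p.2 * v₂ p.1 * φ p.2
            - κ p.1 * uxx p.1 p.2 * v₂ p.1 * deriv φ p.2) =
        ∫ t in Ioo 0 T, (g t * v ℓ + M t * v₁ ℓ) * φ t)

/-! ### The constants -/

/-- `C_θ² = (2 h cos θ / π)²`. -/
def CthetaSq (h θ : ℝ) : ℝ := (2 * h * Real.cos θ / Real.pi) ^ 2

/-- `ℓ̂ = ℓ + ℓ³ / 3`. -/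
def ellHat (ℓ : ℝ) : ℝ := ℓ + ℓ ^ 3 / 3

/-- `C_0² = 4 ℓ̂ (1 + T) / r₀²`. -/
def C0Sq (ℓ T r₀ : ℝ) : ℝ := 4 * ellHat ℓ * (1 + T) / r₀ ^ 2

/-- `C_e² = exp T`. -/
def CeSq (T : ℝ) : ℝ := Real.exp T

/-- `C_1² = C_0² (1 + C_θ²) C_e²`. -/
def C1Sq (ℓ T h θ r₀ : ℝ) : ℝ := C0Sq ℓ T r₀ * (1 + CthetaSq h θ) * CeSq T

/-- `C_2² = C_0² (1 + C_θ²) (1 + C_e²)`. -/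
def C2Sq (ℓ T h θ r₀ : ℝ) : ℝ := C0Sq ℓ T r₀ * (1 + CthetaSq h θ) * (1 + CeSq T)

/-- `C_3² = (ℓ³ / 3) (C_1² + r₀ C_2² / (4 κ₀))`. -/
def C3Sq (ℓ T h θ r₀ κ₀ : ℝ) : ℝ :=
  ℓ ^ 3 / 3 * (C1Sq ℓ T h θ r₀ + r₀ / (4 * κ₀) * C2Sq ℓ T h θ r₀)

end AFMBeam

end

namespace AFMBeam

/-! Formally, test the equation with u_t. The internal damping κ controls u_xxt in L², and
integrating the boundary work g ∂ₜ(u(ℓ) + c u_x(ℓ)), with M = c g, by parts in time leaves only g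
and g' against quantities controlled by ‖u_xx‖; Gronwall's inequality closes the estimate. The tip
is reached through u(ℓ) = ∫ (ℓ - x) u_xx dx, and Cauchy-Schwarz gives the factor ℓ³/3.

The weak formulation does not allow a solution to be tested with its own time derivative. Everything
is therefore convolved in time with a smooth kernel η supported in (0, ∞). Then s ↦ η(t - s) is an
admissible time test, so the weak formulation becomes an equation at each t ≤ T
(`mollified_equation`). Time tests may be nonzero at 0, so the zero initial data are built in.
`tip_estimate` combines this equation with `gronwall_of_energy_inequality` and bounds the mollified
tip and its derivative by the L² norm of η' * g. Since g(0) = 0, that function is η * g'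
(`tconv_deriv_eq`), of norm at most ‖g'‖ for every normalised nonnegative η
(`integral_tconv_sq_le`). These bounds are uniform in η, and `memH1_of_tconv_bounded` passes them to
the limit by weak compactness without loss in the constants. -/

/-! ### Integration and weak derivatives on an interval -/

theorem sq_integral_mul_le {α : Type*} [MeasurableSpace α] {m : Measure α} {f g : α → ℝ}
    (hf : MemLp f 2 m) (hg : MemLp g 2 m) :
    (∫ x, f x * g x ∂m) ^ 2 ≤ (∫ x, f x ^ 2 ∂m) * ∫ x, g x ^ 2 ∂m := by
  have hfg : Integrable (fun x => f x * g x) m := hf.integrable_mul hg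
  have h : ∀ c : ℝ, 0 ≤ (∫ x, f x ^ 2 ∂m) * (c * c) + (2 * ∫ x, f x * g x ∂m) * c
      + ∫ x, g x ^ 2 ∂m := by
    intro c
    have h0 : 0 ≤ ∫ x, (c * f x + g x) ^ 2 ∂m := integral_nonneg fun x => sq_nonneg _
    have h1 : ∫ x, (c * f x + g x) ^ 2 ∂m =
        ∫ x, ((c * c) * f x ^ 2 + (2 * c) * (f x * g x)) + g x ^ 2 ∂m := by
      congr 1; ext x; ring
    have i1 : Integrable (fun x => (c * c) * f x ^ 2) m := hf.integrable_sq.const_mul _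
    have i2 : Integrable (fun x => (2 * c) * (f x * g x)) m := hfg.const_mul _
    have i12 : Integrable (fun x => (c * c) * f x ^ 2 + (2 * c) * (f x * g x)) m := i1.add i2
    rw [h1, integral_add i12 hg.integrable_sq, integral_add i1 i2, integral_const_mul,
      integral_const_mul] at h0
    linarith
  have := discrim_le_zero h
  unfold discrim at this
  nlinarith

/-- Integration by parts for absolutely continuous functions. The primitive vanishes at a, so φ has
to vanish only at b; this allows φ to be a causal kernel s ↦ η(t - s) or the weight ℓ - x. -/
theorem integral_primitive_mul_deriv {a b : ℝ} (hab : a ≤ b) {f φ : ℝ → ℝ}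
    (hf : IntegrableOn f (Ioo a b)) (hφ : ContDiff ℝ 1 φ) (hb : φ b = 0) :
    ∫ x in Ioo a b, (∫ s in a..x, f s) * deriv φ x = -∫ x in Ioo a b, f x * φ x := by
  have hfi : IntervalIntegrable f volume a b := by
    rw [intervalIntegrable_iff_integrableOn_Ioo_of_le hab]; exact hf
  have hac := hfi.absolutelyContinuousOnInterval_intervalIntegral (c := a) (by simp)
  obtain ⟨K, hK⟩ :=
    (hφ.locallyLipschitz.locallyLipschitzOn (s := uIcc a b)).exists_lipschitzOnWith_of_compact isCompact_uIcc
  have hacφ := hK.absolutelyContinuousOnInterval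
  have key := hac.integral_mul_deriv_eq_deriv_mul hacφ
  have hd : ∫ x in a..b, deriv (fun y => ∫ s in a..y, f s) x * φ x = ∫ x in a..b, f x * φ x := by
    apply intervalIntegral.integral_congr_ae
    filter_upwards [hfi.ae_hasDerivAt_integral] with x hx hx'
    rw [(hx (uIoc_subset_uIcc hx') a (by simp)).deriv]
  rw [hd, hb] at key
  simp only [mul_zero, intervalIntegral.integral_same, zero_mul, sub_zero, zero_sub] at key
  rwa [intervalIntegral.integral_of_le hab, intervalIntegral.integral_of_le hab,
    integral_Ioc_eq_integral_Ioo, integral_Ioc_eq_integral_Ioo] at key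

theorem eq_zero_right_of_tsupport_subset_Ioo {a b : ℝ} {φ : ℝ → ℝ} (h : tsupport φ ⊆ Ioo a b) :
    φ b = 0 := by
  by_contra hb
  exact absurd (h (subset_tsupport φ hb)).2 (lt_irrefl b)

theorem continuousOn_primitive_Icc {a b : ℝ} {f : ℝ → ℝ} (hf : IntegrableOn f (Ioo a b)) :
    ContinuousOn (fun x => ∫ s in a..x, f s) (Icc a b) :=
  intervalIntegral.continuousOn_primitive ((integrableOn_Icc_iff_integrableOn_Ioo).2 hf) |>.congr
    fun x hx => intervalIntegral.integral_of_le hx.1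

theorem hasWeakDerivOn_primitive {a b : ℝ} (hab : a ≤ b) {f : ℝ → ℝ}
    (hf : IntegrableOn f (Ioo a b)) :
    HasWeakDerivOn a b (fun x => ∫ s in a..x, f s) f where
  locInt := ((continuousOn_primitive_Icc hf).mono Ioo_subset_Icc_self).locallyIntegrableOn
    measurableSet_Ioo
  locInt' := hf.locallyIntegrableOn
  integral_eq φ hφ _ hs := integral_primitive_mul_deriv hab hf
    (hφ.of_le (by exact_mod_cast le_top)) (eq_zero_right_of_tsupport_subset_Ioo hs)

theorem integrable_mul_test {a b : ℝ} {f φ : ℝ → ℝ} (hf : LocallyIntegrableOn f (Ioo a b))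
    (hφ : Continuous φ) (hc : HasCompactSupport φ) (hs : tsupport φ ⊆ Ioo a b) :
    Integrable (fun x => f x * φ x) := by
  have h1 : IntegrableOn f (tsupport φ) := hf.integrableOn_compact_subset hs hc
  have h2 : IntegrableOn (fun x => f x * φ x) (tsupport φ) :=
    h1.mul_continuousOn hφ.continuousOn hc
  refine (integrableOn_iff_integrable_of_support_subset ?_).1 h2
  intro x hx
  exact subset_tsupport φ fun h => hx (by simp [h])

theorem ae_eq_of_integral_mul_test_eq {a b : ℝ} {f₁ f₂ : ℝ → ℝ}
    (h₁ : LocallyIntegrableOn f₁ (Ioo a b)) (h₂ : LocallyIntegrableOn f₂ (Ioo a b))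
    (h : ∀ φ : ℝ → ℝ, ContDiff ℝ ∞ φ → HasCompactSupport φ → tsupport φ ⊆ Ioo a b →
      ∫ x in Ioo a b, f₁ x * φ x = ∫ x in Ioo a b, f₂ x * φ x) :
    ∀ᵐ x ∂(volume.restrict (Ioo a b)), f₁ x = f₂ x := by
  rw [ae_restrict_iff' measurableSet_Ioo]
  have key := isOpen_Ioo.ae_eq_zero_of_integral_contDiff_smul_eq_zero (μ := volume)
    (h₁.sub h₂) (U := Ioo a b) (f := f₁ - f₂) ?_
  · filter_upwards [key] with x hx hx'
    simpa [sub_eq_zero] using hx hx'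
  · intro φ hφ hc hs
    have i1 := integrable_mul_test h₁ hφ.continuous hc hs
    have i2 := integrable_mul_test h₂ hφ.continuous hc hs
    have e := h φ hφ hc hs
    have hsupp : ∀ f : ℝ → ℝ, ∫ x in Ioo a b, f x * φ x = ∫ x, f x * φ x := fun f =>
      setIntegral_eq_integral_of_forall_compl_eq_zero fun x hx => by
        rw [image_eq_zero_of_notMem_tsupport fun h => hx (hs h), mul_zero]
    rw [hsupp, hsupp] at e
    calc ∫ x, φ x • (f₁ - f₂) x = ∫ x, f₁ x * φ x - f₂ x * φ x := by
          congr 1; ext x; simp only [smul_eq_mul, Pi.sub_apply]; ring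
      _ = 0 := by rw [integral_sub i1 i2, e, sub_self]

theorem HasWeakDerivOn.ae_unique {a b : ℝ} {f f₁ f₂ : ℝ → ℝ} (h₁ : HasWeakDerivOn a b f f₁)
    (h₂ : HasWeakDerivOn a b f f₂) : ∀ᵐ x ∂(volume.restrict (Ioo a b)), f₁ x = f₂ x :=
  ae_eq_of_integral_mul_test_eq h₁.locInt' h₂.locInt' fun φ hφ hc hs => by
    have e1 := h₁.integral_eq φ hφ hc hs
    have e2 := h₂.integral_eq φ hφ hc hs
    linarith

theorem HasWeakDerivOn.ae_weakDeriv {a b : ℝ} {f f' : ℝ → ℝ} (h : HasWeakDerivOn a b f f') :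
    ∀ᵐ x ∂(volume.restrict (Ioo a b)), weakDeriv a b f x = f' x := by
  have hex : ∃ f' : ℝ → ℝ, HasWeakDerivOn a b f f' := ⟨f', h⟩
  have : HasWeakDerivOn a b f (weakDeriv a b f) := by
    unfold weakDeriv
    rw [dif_pos hex]
    exact hex.choose_spec
  exact this.ae_unique h

theorem HasWeakDerivOn.l2NormSq_weakDeriv {a b : ℝ} {f f' : ℝ → ℝ} (h : HasWeakDerivOn a b f f') :
    l2NormSq a b (weakDeriv a b f) = l2NormSq a b f' :=
  integral_congr_ae (h.ae_weakDeriv.mono fun x hx => by simp only [hx])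

/-- A smooth function with integral zero and support in `(a, b)` has a primitive with support in
`(a, b)`. -/
theorem exists_test_primitive {a b : ℝ} {χ : ℝ → ℝ} (hχ : ContDiff ℝ ∞ χ)
    (hc : HasCompactSupport χ) (hs : tsupport χ ⊆ Ioo a b) (h0 : ∫ x in Ioo a b, χ x = 0) :
    ∃ φ : ℝ → ℝ, ContDiff ℝ ∞ φ ∧ HasCompactSupport φ ∧ tsupport φ ⊆ Ioo a b ∧ deriv φ = χ := by
  obtain ⟨c, d, hK, hcd⟩ : ∃ c d, tsupport χ ⊆ Icc c d ∧ Icc c d ⊆ Ioo a b := by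
    rcases (tsupport χ).eq_empty_or_nonempty with h | h
    · exact ⟨1, 0, by simp [h], by simp⟩
    · obtain ⟨c, hcm, hcl⟩ := hc.isCompact.exists_isLeast h
      obtain ⟨d, hdm, hdl⟩ := hc.isCompact.exists_isGreatest h
      exact ⟨c, d, fun x hx => ⟨hcl hx, hdl hx⟩,
        fun x hx => ⟨(hs hcm).1.trans_le hx.1, hx.2.trans_lt (hs hdm).2⟩⟩
  have hz : ∀ x, x ∉ Icc c d → χ x = 0 := fun x hx =>
    image_eq_zero_of_notMem_tsupport fun h => hx (hK h)
  have hza : ∀ x, x ≤ a → χ x = 0 := fun x hx => hz x fun h => absurd (hcd h).1 (not_lt.2 hx)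
  have hd : ∀ x, HasDerivAt (fun y => ∫ s in a..y, χ s) (χ x) x := fun x =>
    intervalIntegral.integral_hasDerivAt_right (hχ.continuous.intervalIntegrable _ _)
      hχ.continuous.aestronglyMeasurable.stronglyMeasurableAtFilter hχ.continuous.continuousAt
  have hder : deriv (fun y => ∫ s in a..y, χ s) = χ := funext fun x => (hd x).deriv
  have hout : ∀ x, x ∉ Icc c d → ∫ s in a..x, χ s = 0 := by
    intro x hx
    by_cases hxc : x < c
    · rw [intervalIntegral.integral_zero_ae]
      refine Filter.Eventually.of_forall fun s hs' => ?_
      by_cases hsc : s ∈ Icc c d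
      · rcases le_total a x with h | h
        · rw [uIoc_of_le h] at hs'
          exact absurd (hs'.2.trans_lt hxc) (not_lt.2 hsc.1)
        · rw [uIoc_of_ge h] at hs'
          exact hza s hs'.2
      · exact hz s hsc
    · have hdx : d < x := by
        by_contra h
        exact hx ⟨not_lt.1 hxc, not_lt.1 h⟩
      -- To the right of the support the primitive has collected the whole integral of χ, which is
      -- zero.
      have hsub : ∫ s in a..x, χ s = ∫ s in Ioo a b, χ s := by
        rcases le_total a x with h | h
        · rw [intervalIntegral.integral_of_le h,
            setIntegral_eq_integral_of_forall_compl_eq_zero,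
            setIntegral_eq_integral_of_forall_compl_eq_zero]
          · intro s hs'
            exact hz s fun hm => hs' (hcd hm)
          · intro s hs'
            refine hz s fun hm => hs' ⟨(hcd hm).1, hm.2.trans hdx.le⟩
        · rw [h0, intervalIntegral.integral_zero_ae]
          refine Filter.Eventually.of_forall fun s hs' => ?_
          rw [uIoc_of_ge h] at hs'
          exact hza s hs'.2
      rw [hsub, h0]
  have hsupp : tsupport (fun y => ∫ s in a..y, χ s) ⊆ Icc c d := by
    refine closure_minimal (fun x hx => ?_) isClosed_Icc
    by_contra h
    exact hx (hout x h)
  refine ⟨_, ?_, HasCompactSupport.of_support_subset_isCompact isCompact_Icc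
    ((subset_tsupport _).trans hsupp), hsupp.trans hcd, hder⟩
  rw [contDiff_infty_iff_deriv, hder]
  exact ⟨fun x => (hd x).differentiableAt, hχ⟩

theorem exists_test_integral_eq_one {a b : ℝ} (hab : a < b) :
    ∃ ψ : ℝ → ℝ, ContDiff ℝ ∞ ψ ∧ HasCompactSupport ψ ∧ tsupport ψ ⊆ Ioo a b ∧
      (∀ x, 0 ≤ ψ x) ∧ ∫ x, ψ x = 1 := by
  let β : ContDiffBump ((a + b) / 2) := ⟨(b - a) / 8, (b - a) / 4, by linarith, by linarith⟩
  refine ⟨β.normed volume, β.contDiff_normed, β.hasCompactSupport_normed, ?_,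
    fun x => β.nonneg_normed x, β.integral_normed⟩
  rw [β.tsupport_normed_eq, Real.closedBall_eq_Icc]
  intro x hx
  have e : β.rOut = (b - a) / 4 := rfl
  rw [e] at hx
  exact ⟨by linarith [hx.1], by linarith [hx.2]⟩

/-- The lemma of du Bois-Reymond. -/
theorem exists_ae_eq_const_of_integral_mul_deriv_eq_zero {a b : ℝ} (hab : a < b) {f : ℝ → ℝ}
    (hf : LocallyIntegrableOn f (Ioo a b))
    (h : ∀ φ : ℝ → ℝ, ContDiff ℝ ∞ φ → HasCompactSupport φ → tsupport φ ⊆ Ioo a b →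
      ∫ x in Ioo a b, f x * deriv φ x = 0) :
    ∃ C, ∀ᵐ x ∂(volume.restrict (Ioo a b)), f x = C := by
  obtain ⟨ψ, hψ, hψc, hψs, -, hψ1⟩ := exists_test_integral_eq_one hab
  have hψ1' : ∫ x in Ioo a b, ψ x = 1 := by
    rw [setIntegral_eq_integral_of_forall_compl_eq_zero, hψ1]
    exact fun x hx => image_eq_zero_of_notMem_tsupport fun h => hx (hψs h)
  refine ⟨∫ x in Ioo a b, f x * ψ x, ae_eq_of_integral_mul_test_eq hf
    (continuous_const.locallyIntegrable.locallyIntegrableOn _) fun χ hχ hχc hχs => ?_⟩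
  set J := ∫ x in Ioo a b, χ x with hJ
  -- Subtracting J ψ makes the mean of χ zero, so the difference is the derivative of a test
  -- function.
  have hs' : tsupport (fun x => χ x - J * ψ x) ⊆ Ioo a b := by
    refine (tsupport_sub χ (fun x => J * ψ x)).trans (union_subset hχs ?_)
    exact (closure_mono fun x hx => right_ne_zero_of_mul hx).trans hψs
  have hc' : HasCompactSupport (fun x => χ x - J * ψ x) := hχc.sub hψc.mul_left
  have ic : IntegrableOn χ (Ioo a b) := (hχ.continuous.integrable_of_hasCompactSupport hχc).integrableOn
  have ip : IntegrableOn ψ (Ioo a b) := (hψ.continuous.integrable_of_hasCompactSupport hψc).integrableOn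
  obtain ⟨φ, hφ, hφc, hφs, hd⟩ := exists_test_primitive (a := a) (b := b)
    (hχ.sub (contDiff_const.mul hψ)) hc' hs' (by
      rw [integral_sub ic (ip.const_mul _), integral_const_mul, hψ1', hJ]; ring)
  have e := h φ hφ hφc hφs
  rw [hd] at e
  have i1 := (integrable_mul_test hf hχ.continuous hχc hχs).integrableOn (s := Ioo a b)
  have i2 := (integrable_mul_test hf hψ.continuous hψc hψs).integrableOn (s := Ioo a b)
  have e2 : ∫ x in Ioo a b, f x * (χ x - J * ψ x) =
      ∫ x in Ioo a b, f x * χ x - J * (f x * ψ x) := by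
    congr 1; ext x; ring
  rw [e2, integral_sub i1 (i2.const_mul _), integral_const_mul] at e
  rw [integral_const_mul, ← hJ]
  linarith

/-- The difference of f and the primitive has weak derivative zero, hence is constant almost
everywhere by du Bois-Reymond; continuity extends this to every point, endpoints included. -/
theorem HasWeakDerivOn.eq_add_primitive {a b : ℝ} (hab : a < b) {f f' : ℝ → ℝ}
    (h : HasWeakDerivOn a b f f') (hf : ContinuousOn f (Icc a b))
    (hf' : IntegrableOn f' (Ioo a b)) {x : ℝ} (hx : x ∈ Icc a b) :
    f x = f a + ∫ s in a..x, f' s := by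
  have hp := hasWeakDerivOn_primitive hab.le hf'
  have hpc := continuousOn_primitive_Icc hf'
  obtain ⟨C, hC⟩ := exists_ae_eq_const_of_integral_mul_deriv_eq_zero hab (h.locInt.sub hp.locInt)
    fun φ hφ hc hs => by
      have e1 := h.integral_eq φ hφ hc hs
      have e2 := hp.integral_eq φ hφ hc hs
      have hs' : tsupport (deriv φ) ⊆ Ioo a b := (tsupport_deriv_subset (𝕜 := ℝ)).trans hs
      have i1 := (integrable_mul_test h.locInt (hφ.continuous_deriv (by simp)) hc.deriv
        hs').integrableOn (s := Ioo a b)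
      have i2 := (integrable_mul_test hp.locInt (hφ.continuous_deriv (by simp)) hc.deriv
        hs').integrableOn (s := Ioo a b)
      simp only [Pi.sub_apply, sub_mul]
      rw [integral_sub i1 i2, e1, e2, sub_self]
  have hcc : ContinuousOn (fun x => f x - ∫ s in a..x, f' s) (Icc a b) := hf.sub hpc
  have hIoo : EqOn (fun x => f x - ∫ s in a..x, f' s) (fun _ => C) (Ioo a b) :=
    Measure.eqOn_open_of_ae_eq (μ := volume) hC isOpen_Ioo
      (hcc.mono Ioo_subset_Icc_self) continuousOn_const
  have hIcc : EqOn (fun x => f x - ∫ s in a..x, f' s) (fun _ => C) (Icc a b) := by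
    refine hIoo.of_subset_closure hcc continuousOn_const Ioo_subset_Icc_self ?_
    rw [closure_Ioo hab.ne]
  have ha := hIcc (left_mem_Icc.2 hab.le)
  have hx' := hIcc hx
  simp only [intervalIntegral.integral_same, sub_zero] at ha hx'
  linarith

/-! ### Causal mollification in time -/

/-- A smooth convolution kernel supported in the past. -/
structure IsCausalKernel (η : ℝ → ℝ) : Prop where
  smooth : ContDiff ℝ ∞ η
  compact : HasCompactSupport η
  supp : tsupport η ⊆ Ioi 0

/-- The convolution in time `(η * f)(t)`, where `f` is extended by zero outside `(0, T)`. -/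
noncomputable def tconv (T : ℝ) (η f : ℝ → ℝ) (t : ℝ) : ℝ :=
  ∫ s in Ioo 0 T, η (t - s) * f s

namespace IsCausalKernel

variable {η : ℝ → ℝ}

theorem deriv (hη : IsCausalKernel η) : IsCausalKernel (deriv η) where
  smooth := (contDiff_infty_iff_deriv.1 hη.smooth).2
  compact := hη.compact.deriv
  supp := (tsupport_deriv_subset (𝕜 := ℝ)).trans hη.supp

theorem eq_zero_of_nonpos (hη : IsCausalKernel η) {t : ℝ} (ht : t ≤ 0) : η t = 0 :=
  image_eq_zero_of_notMem_tsupport fun h => absurd (hη.supp h) (not_lt.2 ht)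

theorem exists_bound (hη : IsCausalKernel η) : ∃ C, 0 ≤ C ∧ ∀ x, |η x| ≤ C := by
  obtain ⟨C, hC⟩ := hη.compact.exists_bound_of_continuous hη.smooth.continuous
  exact ⟨C, (norm_nonneg _).trans (hC 0), hC⟩

theorem hasDerivAt (hη : IsCausalKernel η) (x : ℝ) : HasDerivAt η (_root_.deriv η x) x :=
  ((contDiff_infty_iff_deriv.1 hη.smooth).1 x).hasDerivAt

/-- Causality places the support strictly before t, hence before T, and nothing is required at s =
0. This is what makes the weak formulation usable at each fixed time, t = T included. -/
theorem isTimeTest (hη : IsCausalKernel η) {t T : ℝ} (ht : t ≤ T) :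
    IsTimeTest T (fun s => η (t - s)) where
  smooth := hη.smooth.comp (contDiff_const.sub contDiff_id)
  compact := hη.compact.comp_homeomorph (Homeomorph.subLeft t)
  supp := by
    have : tsupport (fun s => η (t - s)) ⊆ (fun s => t - s) ⁻¹' tsupport η :=
      closure_minimal (fun s hs => subset_tsupport η hs)
        ((isClosed_tsupport η).preimage (by fun_prop))
    intro s hs
    have h2 : (0 : ℝ) < t - s := hη.supp (this hs)
    exact mem_Iio.2 (by linarith)

theorem deriv_comp_sub (hη : IsCausalKernel η) (t s : ℝ) :
    _root_.deriv (fun s => η (t - s)) s = -_root_.deriv η (t - s) := by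
  have := (hη.hasDerivAt (t - s)).comp s ((hasDerivAt_id s).const_sub t)
  simpa [Function.comp_def] using this.deriv

variable {T : ℝ} {f : ℝ → ℝ}

theorem integrable_mul (hη : IsCausalKernel η) (hf : IntegrableOn f (Ioo 0 T)) (t : ℝ) :
    IntegrableOn (fun s => η (t - s) * f s) (Ioo 0 T) := by
  obtain ⟨C, -, hC⟩ := hη.exists_bound
  exact hf.bdd_mul (hη.smooth.continuous.comp (by fun_prop)).aestronglyMeasurable
    (Filter.Eventually.of_forall fun s => hC (t - s))

theorem abs_tconv_le (hη : IsCausalKernel η) (hf : IntegrableOn f (Ioo 0 T)) {C : ℝ}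
    (hC : ∀ x, |η x| ≤ C) (t : ℝ) : |tconv T η f t| ≤ C * ∫ s in Ioo 0 T, |f s| := by
  unfold tconv
  refine abs_integral_le_integral_abs.trans ?_
  rw [← integral_const_mul]
  refine integral_mono (hη.integrable_mul hf t).abs (hf.abs.const_mul C) fun s => ?_
  simp only [abs_mul]
  exact mul_le_mul_of_nonneg_right (hC _) (abs_nonneg _)

theorem tconv_eq_zero (hη : IsCausalKernel η) {t : ℝ} (ht : t ≤ 0) : tconv T η f t = 0 := by
  refine setIntegral_eq_zero_of_forall_eq_zero fun s hs => ?_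
  rw [hη.eq_zero_of_nonpos (by linarith [hs.1]), zero_mul]

theorem hasDerivAt_tconv (hη : IsCausalKernel η) (hf : IntegrableOn f (Ioo 0 T)) (t : ℝ) :
    HasDerivAt (tconv T η f) (tconv T (_root_.deriv η) f t) t := by
  obtain ⟨C, -, hC⟩ := hη.deriv.exists_bound
  refine (hasDerivAt_integral_of_dominated_loc_of_deriv_le (F := fun t s => η (t - s) * f s)
    (F' := fun t s => _root_.deriv η (t - s) * f s) (bound := fun s => C * |f s|)
    Filter.univ_mem (Filter.Eventually.of_forall fun t =>
      (hη.integrable_mul hf t).aestronglyMeasurable)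
    (hη.integrable_mul hf t) (hη.deriv.integrable_mul hf t).aestronglyMeasurable
    (Filter.Eventually.of_forall fun s t _ => ?_) (hf.abs.const_mul C)
    (Filter.Eventually.of_forall fun s t _ => ?_)).2
  · rw [norm_mul]
    exact mul_le_mul_of_nonneg_right (hC _) (abs_nonneg _)
  · have := (hη.hasDerivAt (t - s)).comp t ((hasDerivAt_id t).sub_const s)
    simpa using this.mul_const (f s)

theorem continuous_tconv (hη : IsCausalKernel η) (hf : IntegrableOn f (Ioo 0 T)) :
    Continuous (tconv T η f) :=
  continuous_iff_continuousAt.2 fun t => (hη.hasDerivAt_tconv hf t).continuousAt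

end IsCausalKernel

theorem tconv_congr {T : ℝ} {η f₁ f₂ : ℝ → ℝ}
    (h : ∀ᵐ s ∂(volume.restrict (Ioo 0 T)), f₁ s = f₂ s) (t : ℝ) :
    tconv T η f₁ t = tconv T η f₂ t :=
  integral_congr_ae (h.mono fun s hs => by simp only [hs])

/-! ### Functions in `L²` of the space-time domain -/

namespace MemL2Omega

variable {ℓ T : ℝ} {w : ℝ → ℝ → ℝ}

theorem restrict_Omega (ℓ T : ℝ) : (volume : Measure (ℝ × ℝ)).restrict (Omega ℓ T) =
    (volume.restrict (Ioo 0 ℓ)).prod (volume.restrict (Ioo 0 T)) := by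
  rw [Omega, Measure.volume_eq_prod, Measure.prod_restrict]

theorem memLp_prod (hw : MemL2Omega ℓ T w) : MemLp (fun p : ℝ × ℝ => w p.1 p.2) 2
    ((volume.restrict (Ioo 0 ℓ)).prod (volume.restrict (Ioo 0 T))) := by
  rw [← restrict_Omega]; exact hw

theorem integrable_prod (hw : MemL2Omega ℓ T w) : Integrable (fun p : ℝ × ℝ => w p.1 p.2)
    ((volume.restrict (Ioo 0 ℓ)).prod (volume.restrict (Ioo 0 T))) :=
  hw.memLp_prod.integrable (by norm_num)

theorem ae_memL2 (hw : MemL2Omega ℓ T w) :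
    ∀ᵐ x ∂(volume.restrict (Ioo 0 ℓ)), MemL2 0 T (w x) := by
  filter_upwards [hw.integrable_prod.prod_right_ae, hw.memLp_prod.integrable_sq.prod_right_ae]
    with x h1 h2
  exact (memLp_two_iff_integrable_sq h1.aestronglyMeasurable).2 h2

theorem ae_integrable (hw : MemL2Omega ℓ T w) :
    ∀ᵐ x ∂(volume.restrict (Ioo 0 ℓ)), IntegrableOn (w x) (Ioo 0 T) :=
  hw.integrable_prod.prod_right_ae

/-- This function of x, times a bound for the kernel, dominates the convolution for all t at once;
it justifies differentiating the energy under the integral sign. -/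
theorem memLp_integral_abs (hw : MemL2Omega ℓ T w) :
    MemLp (fun x => ∫ s in Ioo 0 T, |w x s|) 2 (volume.restrict (Ioo 0 ℓ)) := by
  have hm : AEStronglyMeasurable (fun x => ∫ s in Ioo 0 T, |w x s|)
      (volume.restrict (Ioo 0 ℓ)) := hw.integrable_prod.abs.aestronglyMeasurable.integral_prod_right'
  rw [memLp_two_iff_integrable_sq hm]
  refine Integrable.mono' (hw.memLp_prod.integrable_sq.integral_prod_left.const_mul
    (∫ s in Ioo 0 T, (1 : ℝ) ^ 2)) (hm.pow 2) ?_
  filter_upwards [hw.ae_memL2] with x hx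
  rw [Real.norm_of_nonneg (sq_nonneg _)]
  have := sq_integral_mul_le (m := volume.restrict (Ioo 0 T)) (f := fun _ => 1)
    (g := fun s => |w x s|) (memLp_const 1) hx.abs
  simpa using this

theorem aestronglyMeasurable_tconv (hw : MemL2Omega ℓ T w) {η : ℝ → ℝ} (hη : IsCausalKernel η)
    (t : ℝ) : AEStronglyMeasurable (fun x => tconv T η (w x) t) (volume.restrict (Ioo 0 ℓ)) :=
  AEStronglyMeasurable.integral_prod_right' (f := fun p : ℝ × ℝ => η (t - p.2) * w p.1 p.2)
    ((hη.smooth.continuous.comp (by fun_prop)).aestronglyMeasurable.mul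
      hw.integrable_prod.aestronglyMeasurable)

theorem memL2_tconv (hw : MemL2Omega ℓ T w) {η : ℝ → ℝ} (hη : IsCausalKernel η) (t : ℝ) :
    MemL2 0 ℓ (fun x => tconv T η (w x) t) := by
  obtain ⟨C, -, hC⟩ := hη.exists_bound
  refine (hw.memLp_integral_abs.const_mul C).of_le (hw.aestronglyMeasurable_tconv hη t) ?_
  filter_upwards [hw.ae_integrable] with x hx
  exact (hη.abs_tconv_le hx hC t).trans (le_abs_self _)

theorem hasDerivAt_integral_tconv_sq (hw : MemL2Omega ℓ T w) {η c : ℝ → ℝ} (hη : IsCausalKernel η)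
    (hc : MemLp c ⊤ (volume.restrict (Ioo 0 ℓ))) (t : ℝ) :
    HasDerivAt (fun t => ∫ x in Ioo 0 ℓ, c x * tconv T η (w x) t ^ 2)
      (∫ x in Ioo 0 ℓ, c x * (2 * tconv T η (w x) t * tconv T (deriv η) (w x) t)) t := by
  obtain ⟨C, hC0, hC⟩ := hη.exists_bound
  obtain ⟨C', hC0', hC'⟩ := hη.deriv.exists_bound
  have hi : ∀ t, Integrable (fun x => c x * tconv T η (w x) t ^ 2) (volume.restrict (Ioo 0 ℓ)) :=
    fun t => (hw.memL2_tconv hη t).integrable_sq.mul_of_top_right hc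
  refine (hasDerivAt_integral_of_dominated_loc_of_deriv_le
    (F := fun t x => c x * tconv T η (w x) t ^ 2)
    (F' := fun t x => c x * (2 * tconv T η (w x) t * tconv T (deriv η) (w x) t))
    (bound := fun x => |c x| * ((2 * C * C') * (∫ s in Ioo 0 T, |w x s|) ^ 2))
    Filter.univ_mem (Filter.Eventually.of_forall fun t => (hi t).aestronglyMeasurable) (hi t)
    (hc.1.mul (((hw.memL2_tconv hη t).1.const_mul 2).mul (hw.memL2_tconv hη.deriv t).1))
    ?_ ?_ ?_).2
  · filter_upwards [hw.ae_integrable] with x hx t _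
    rw [norm_mul, Real.norm_eq_abs, Real.norm_eq_abs, abs_mul, abs_mul, abs_two]
    refine mul_le_mul_of_nonneg_left ?_ (abs_nonneg _)
    have h1 := hη.abs_tconv_le hx hC t
    have h2 := hη.deriv.abs_tconv_le hx hC' t
    have := mul_le_mul h1 h2 (abs_nonneg _) ((abs_nonneg _).trans h1)
    nlinarith
  · exact (hw.memLp_integral_abs.integrable_sq.const_mul _).mul_of_top_right hc.abs
  · filter_upwards [hw.ae_integrable] with x hx t _
    simpa using ((hη.hasDerivAt_tconv hx t).pow 2).const_mul (c x)

theorem continuous_integral_tconv_sq (hw : MemL2Omega ℓ T w) {η c : ℝ → ℝ} (hη : IsCausalKernel η)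
    (hc : MemLp c ⊤ (volume.restrict (Ioo 0 ℓ))) :
    Continuous (fun t => ∫ x in Ioo 0 ℓ, c x * tconv T η (w x) t ^ 2) :=
  continuous_iff_continuousAt.2 fun t => (hw.hasDerivAt_integral_tconv_sq hη hc t).continuousAt

theorem integrable_mul_mul (hw : MemL2Omega ℓ T w) {η a : ℝ → ℝ} (hη : IsCausalKernel η)
    (ha : MemL2 0 ℓ a) (t : ℝ) : Integrable (fun p : ℝ × ℝ => η (t - p.2) * (a p.1 * w p.1 p.2))
    ((volume.restrict (Ioo 0 ℓ)).prod (volume.restrict (Ioo 0 T))) := by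
  obtain ⟨C, -, hC⟩ := hη.exists_bound
  refine Integrable.bdd_mul (c := C) ?_
    (hη.smooth.continuous.comp (by fun_prop)).aestronglyMeasurable
    (Filter.Eventually.of_forall fun s => hC _)
  exact (ha.comp_fst (volume.restrict (Ioo 0 T))).integrable_mul hw.memLp_prod

theorem integral_mul_mul (hw : MemL2Omega ℓ T w) {η a : ℝ → ℝ} (hη : IsCausalKernel η)
    (ha : MemL2 0 ℓ a) (t : ℝ) :
    ∫ p in Omega ℓ T, η (t - p.2) * (a p.1 * w p.1 p.2) =
      ∫ x in Ioo 0 ℓ, a x * tconv T η (w x) t := by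
  rw [restrict_Omega, integral_prod _ (hw.integrable_mul_mul hη ha t)]
  congr 1; ext x
  rw [tconv, ← integral_const_mul]
  congr 1; ext s; ring

/-- Fubini: linear functionals of the space variable commute with mollification in time. It is
applied to the weights 1 (tip slope), ℓ - x (tip displacement) and indicators (primitives). -/
theorem integral_mul_tconv (hw : MemL2Omega ℓ T w) {η a : ℝ → ℝ} (hη : IsCausalKernel η)
    (ha : MemL2 0 ℓ a) (t : ℝ) :
    ∫ x in Ioo 0 ℓ, a x * tconv T η (w x) t =
      tconv T η (fun s => ∫ x in Ioo 0 ℓ, a x * w x s) t := by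
  rw [← hw.integral_mul_mul hη ha t, restrict_Omega,
    integral_prod_symm _ (hw.integrable_mul_mul hη ha t), tconv]
  congr 1; ext s
  rw [← integral_const_mul]

theorem memL2_integral_mul (hw : MemL2Omega ℓ T w) {a : ℝ → ℝ} (ha : MemL2 0 ℓ a) :
    MemL2 0 T (fun s => ∫ x in Ioo 0 ℓ, a x * w x s) := by
  have hm : AEStronglyMeasurable (fun s => ∫ x in Ioo 0 ℓ, a x * w x s)
      (volume.restrict (Ioo 0 T)) :=
    AEStronglyMeasurable.integral_prod_right' (f := fun p : ℝ × ℝ => a p.2 * w p.2 p.1)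
      (((ha.comp_fst (volume.restrict (Ioo 0 T))).integrable_mul
        hw.memLp_prod).swap.aestronglyMeasurable)
  refine (memLp_two_iff_integrable_sq hm).2 ?_
  refine Integrable.mono' (hw.memLp_prod.integrable_sq.integral_prod_right.const_mul
    (∫ x in Ioo 0 ℓ, a x ^ 2)) (hm.pow 2) ?_
  filter_upwards [hw.integrable_prod.prod_left_ae, hw.memLp_prod.integrable_sq.prod_left_ae]
    with s h1 h2
  rw [Real.norm_of_nonneg (sq_nonneg _)]
  exact sq_integral_mul_le ha ((memLp_two_iff_integrable_sq h1.aestronglyMeasurable).2 h2)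

theorem integral_primitive_tconv (hw : MemL2Omega ℓ T w) {η : ℝ → ℝ} (hη : IsCausalKernel η)
    {x : ℝ} (hx : x ∈ Icc 0 ℓ) (t : ℝ) :
    ∫ y in (0 : ℝ)..x, tconv T η (w y) t = tconv T η (fun s => ∫ y in (0 : ℝ)..x, w y s) t := by
  have hi : ∀ f : ℝ → ℝ, ∫ y in (0 : ℝ)..x, f y =
      ∫ y in Ioo 0 ℓ, (Ioo 0 x).indicator (fun _ => (1 : ℝ)) y * f y := by
    intro f
    rw [intervalIntegral.integral_of_le hx.1, integral_Ioc_eq_integral_Ioo]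
    have : (fun y => (Ioo 0 x).indicator (fun _ => (1 : ℝ)) y * f y) = (Ioo 0 x).indicator f := by
      ext y; by_cases h : y ∈ Ioo 0 x <;> simp [h]
    rw [this, setIntegral_indicator measurableSet_Ioo,
      inter_eq_self_of_subset_right (Ioo_subset_Ioo_right hx.2)]
  simp only [hi]
  exact hw.integral_mul_tconv hη ((memLp_const 1).indicator measurableSet_Ioo) t

end MemL2Omega

/-! ### The space `𝒱²` -/

theorem MemL2.integrableOn {a b : ℝ} {f : ℝ → ℝ} (hf : MemL2 a b f) : IntegrableOn f (Ioo a b) :=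
  MemLp.integrable (by norm_num) hf

theorem memL2_of_continuousOn {a b : ℝ} {f : ℝ → ℝ} (hf : ContinuousOn f (Icc a b)) :
    MemL2 a b f := by
  obtain ⟨C, hC⟩ := isCompact_Icc.exists_bound_of_continuousOn hf
  refine MemLp.of_bound ((hf.mono Ioo_subset_Icc_self).aestronglyMeasurable measurableSet_Ioo) C ?_
  exact (ae_restrict_iff' measurableSet_Ioo).2
    (Filter.Eventually.of_forall fun x hx => hC x (Ioo_subset_Icc_self hx))

/-- Produces admissible space test functions from an L² second derivative alone, with the clamped
conditions automatic. -/
theorem memV2_primitive {ℓ : ℝ} (hℓ : 0 ≤ ℓ) {w : ℝ → ℝ} (hw : MemL2 0 ℓ w) :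
    MemV2 ℓ (fun x => ∫ y in (0 : ℝ)..x, ∫ z in (0 : ℝ)..y, w z)
      (fun x => ∫ y in (0 : ℝ)..x, w y) w :=
  have hc := continuousOn_primitive_Icc hw.integrableOn
  have hi := (memL2_of_continuousOn hc).integrableOn
  { cont := continuousOn_primitive_Icc hi
    cont₁ := hc
    deriv₁ := hasWeakDerivOn_primitive hℓ hi
    deriv₂ := hasWeakDerivOn_primitive hℓ hw.integrableOn
    memL2 := hw
    clamped := intervalIntegral.integral_same
    clamped₁ := intervalIntegral.integral_same }

namespace MemV2

variable {ℓ : ℝ} {v v₁ v₂ : ℝ → ℝ}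

theorem eq_primitive₁ (hv : MemV2 ℓ v v₁ v₂) (hℓ : 0 < ℓ) {x : ℝ} (hx : x ∈ Icc 0 ℓ) :
    v₁ x = ∫ y in (0 : ℝ)..x, v₂ y := by
  rw [hv.deriv₂.eq_add_primitive hℓ hv.cont₁ hv.memL2.integrableOn hx, hv.clamped₁, zero_add]

theorem eq_primitive (hv : MemV2 ℓ v v₁ v₂) (hℓ : 0 < ℓ) {x : ℝ} (hx : x ∈ Icc 0 ℓ) :
    v x = ∫ y in (0 : ℝ)..x, v₁ y := by
  rw [hv.deriv₁.eq_add_primitive hℓ hv.cont (memL2_of_continuousOn hv.cont₁).integrableOn hx,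
    hv.clamped, zero_add]

theorem tip_slope (hv : MemV2 ℓ v v₁ v₂) (hℓ : 0 < ℓ) : v₁ ℓ = ∫ x in Ioo 0 ℓ, 1 * v₂ x := by
  rw [hv.eq_primitive₁ hℓ (right_mem_Icc.2 hℓ.le), intervalIntegral.integral_of_le hℓ.le,
    integral_Ioc_eq_integral_Ioo]
  simp

/-- The weight ℓ - x vanishes at ℓ, so integrating v₁ by parts leaves no boundary term. Its squared
L² norm is the ℓ³/3 of the constants. -/
theorem tip_displacement (hv : MemV2 ℓ v v₁ v₂) (hℓ : 0 < ℓ) :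
    v ℓ = ∫ x in Ioo 0 ℓ, (ℓ - x) * v₂ x := by
  have h := integral_primitive_mul_deriv hℓ.le hv.memL2.integrableOn (φ := fun x => ℓ - x)
    (by fun_prop) (sub_self ℓ)
  have hd : ∀ x : ℝ, deriv (fun x => ℓ - x) x = -1 := fun x => by simp
  simp only [hd, mul_neg_one, integral_neg, neg_inj] at h
  rw [hv.eq_primitive hℓ (right_mem_Icc.2 hℓ.le), intervalIntegral.integral_of_le hℓ.le,
    integral_Ioc_eq_integral_Ioo,
    setIntegral_congr_fun measurableSet_Ioo fun x hx =>
      hv.eq_primitive₁ hℓ (Ioo_subset_Icc_self hx), h]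
  congr 1; ext x; ring

end MemV2

/-! ### Energy estimate -/

theorem IsCoeff.mul_integral_sq_le {ℓ lo hi : ℝ} {c f : ℝ → ℝ} (hc : IsCoeff ℓ lo hi c)
    (hf : MemL2 0 ℓ f) : lo * ∫ x in Ioo 0 ℓ, f x ^ 2 ≤ ∫ x in Ioo 0 ℓ, c x * f x ^ 2 := by
  rw [← integral_const_mul]
  refine integral_mono_ae (MemLp.integrable_sq hf |>.const_mul lo)
    (MemLp.integrable_sq hf |>.mul_of_top_right hc.1) ?_
  filter_upwards [hc.2] with x hx
  exact mul_le_mul_of_nonneg_right hx.1 (sq_nonneg _)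

/-- Young's inequality, weighted so that absorbing r/4 · w leaves half of the coercivity r/2 · w of
the energy. -/
theorem mul_le_add_of_sq_le {r K w j d : ℝ} (hr : 0 < r) (hK : 0 < K) (hj : j ^ 2 ≤ K * w) :
    d * j ≤ r / 4 * w + K / r * d ^ 2 := by
  have h1 : 0 ≤ r / (4 * K) * (j - 2 * K / r * d) ^ 2 := by positivity
  have h2 : r / (4 * K) * (j - 2 * K / r * d) ^ 2 =
      r / (4 * K) * j ^ 2 - d * j + K / r * d ^ 2 := by
    field_simp; ring
  have h3 : r / (4 * K) * j ^ 2 ≤ r / (4 * K) * (K * w) :=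
    mul_le_mul_of_nonneg_left hj (by positivity)
  have h4 : r / (4 * K) * (K * w) = r / 4 * w := by field_simp
  linarith

/-- The work G j' cannot be bounded by w, but G j' = (G j)' - G' j, and both G j and G' j can, by
Young's inequality. The same share r/4 of w is used in both places, so the Gronwall rate is exactly
1 and the growth factor is exp T. -/
theorem gronwall_of_energy_inequality {T r κ K : ℝ} (hT : 0 ≤ T) (hr : 0 < r) (hκ : 0 < κ)
    (hK : 0 < K) {E E' G G' j j' w P : ℝ → ℝ} (hE : ∀ t, HasDerivAt E (E' t) t)
    (hG : ∀ t, HasDerivAt G (G' t) t) (hj : ∀ t, HasDerivAt j (j' t) t)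
    (hw : Continuous w) (hP : Continuous P) (hG' : Continuous G')
    (hP0 : ∀ t, 0 ≤ P t) (hE0 : E 0 = 0) (hG0 : G 0 = 0)
    (hdiss : ∀ t ∈ Icc 0 T, E' t ≤ -κ * P t + G t * j' t)
    (hcoer : ∀ t, r / 2 * w t ≤ E t) (hjw : ∀ t, j t ^ 2 ≤ K * w t) :
    ∫ t in (0 : ℝ)..T, w t ≤
        4 * K * (1 + T) / r ^ 2 * (∫ t in (0 : ℝ)..T, G' t ^ 2) * (Real.exp T - 1) ∧
    ∫ t in (0 : ℝ)..T, P t ≤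
      r / (4 * κ) * (4 * K * (1 + T) / r ^ 2 * (∫ t in (0 : ℝ)..T, G' t ^ 2) * Real.exp T) := by
  set Q : ℝ → ℝ := fun t => ∫ s in (0 : ℝ)..t, w s with hQ
  set R : ℝ → ℝ := fun t => ∫ s in (0 : ℝ)..t, P s with hR
  set N : ℝ → ℝ := fun t => ∫ s in (0 : ℝ)..t, G' s ^ 2 with hN
  have hQd : ∀ t, HasDerivAt Q (w t) t := fun t => hw.integral_hasStrictDerivAt 0 t |>.hasDerivAt
  have hRd : ∀ t, HasDerivAt R (P t) t := fun t => hP.integral_hasStrictDerivAt 0 t |>.hasDerivAt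
  have hNd : ∀ t, HasDerivAt N (G' t ^ 2) t := fun t =>
    (hG'.pow 2).integral_hasStrictDerivAt 0 t |>.hasDerivAt
  have hQ0 : Q 0 = 0 := intervalIntegral.integral_same
  have hR0 : R 0 = 0 := intervalIntegral.integral_same
  have hN0 : N 0 = 0 := intervalIntegral.integral_same
  have hanti : ∀ F F' : ℝ → ℝ, (∀ t, HasDerivAt F (F' t) t) → (∀ t ∈ Icc 0 T, F' t ≤ 0) →
      ∀ t ∈ Icc 0 T, F t ≤ F 0 := by
    intro F F' hF hF' t ht
    have : AntitoneOn F (Icc 0 T) := antitoneOn_of_deriv_nonpos (convex_Icc 0 T)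
      (fun t _ => (hF t).continuousAt.continuousWithinAt)
      (fun t _ => (hF t).differentiableAt.differentiableWithinAt)
      (fun t ht => by rw [(hF t).deriv]; exact hF' t (interior_subset ht))
    exact this (left_mem_Icc.2 hT) ht ht.1
  -- The integrated energy balance: this functional is nonincreasing and starts from 0.
  have hbal := hanti (fun t => E t - G t * j t + κ * R t - r / 4 * Q t - K / r * N t) _
    (fun t => (((((hE t).sub ((hG t).mul (hj t))).add ((hRd t).const_mul κ)).sub
      ((hQd t).const_mul (r / 4))).sub ((hNd t).const_mul (K / r)))) (fun t ht => by
        have h1 := hdiss t ht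
        have h2 := mul_le_add_of_sq_le (d := -G' t) hr hK (hjw t)
        have h3 : (-G' t) ^ 2 = G' t ^ 2 := by ring
        rw [h3] at h2
        linarith)
  simp only [hE0, hG0, hQ0, hR0, hN0, zero_mul, mul_zero, sub_zero, add_zero] at hbal
  have hNmono : ∀ t ∈ Icc 0 T, N t ≤ N T := fun t ht =>
    intervalIntegral.integral_mono_interval le_rfl ht.1 ht.2
      (Filter.Eventually.of_forall fun s => sq_nonneg _) ((hG'.pow 2).intervalIntegrable _ _)
  -- Cauchy-Schwarz, from G(0) = 0. Together with the N term in the balance it produces the factor 1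
  -- + T.
  have hGN : ∀ t ∈ Icc 0 T, G t ^ 2 ≤ T * N T := by
    intro t ht
    have e : G t = ∫ s in (0 : ℝ)..t, 1 * G' s := by
      simp only [one_mul]
      rw [intervalIntegral.integral_eq_sub_of_hasDerivAt (fun s _ => hG s)
        (hG'.intervalIntegrable _ _), hG0, sub_zero]
    have hm : MemLp G' 2 (volume.restrict (Ioc 0 t)) := by
      rw [← restrict_Ioo_eq_restrict_Ioc]
      exact memL2_of_continuousOn hG'.continuousOn
    have cs := sq_integral_mul_le (m := volume.restrict (Ioc 0 t)) (f := fun _ => 1) (g := G')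
      (memLp_const 1) hm
    rw [← intervalIntegral.integral_of_le ht.1, ← e, ← intervalIntegral.integral_of_le ht.1,
      ← intervalIntegral.integral_of_le ht.1] at cs
    simp only [one_pow, intervalIntegral.integral_const, sub_zero, smul_eq_mul, mul_one] at cs
    have hN0' : 0 ≤ N t := intervalIntegral.integral_nonneg ht.1 fun s _ => sq_nonneg _
    exact cs.trans (mul_le_mul ht.2 (hNmono t ht) hN0' hT)
  set D := 4 * K * (1 + T) / r ^ 2 * N T with hD
  have hmain : ∀ t ∈ Icc 0 T, w t + 4 * κ / r * R t ≤ D + Q t := by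
    intro t ht
    have h1 := hbal t ht
    have h2 := mul_le_add_of_sq_le (d := G t) hr hK (hjw t)
    have h3 : K / r * G t ^ 2 ≤ K / r * (T * N T) :=
      mul_le_mul_of_nonneg_left (hGN t ht) (by positivity)
    have h4 : K / r * N t ≤ K / r * N T := mul_le_mul_of_nonneg_left (hNmono t ht) (by positivity)
    have h5 := hcoer t
    have h6 : r / 4 * w t + κ * R t ≤ r / 4 * Q t + K / r * (1 + T) * N T := by linarith
    have h7 : 4 / r * (r / 4 * w t + κ * R t) ≤ 4 / r * (r / 4 * Q t + K / r * (1 + T) * N T) :=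
      mul_le_mul_of_nonneg_left h6 (by positivity)
    have e1 : 4 / r * (r / 4 * w t + κ * R t) = w t + 4 * κ / r * R t := by field_simp
    have e2 : 4 / r * (r / 4 * Q t + K / r * (1 + T) * N T) = D + Q t := by
      rw [hD]; field_simp; ring
    linarith
  have hRnn : ∀ t ∈ Icc 0 T, 0 ≤ R t := fun t ht =>
    intervalIntegral.integral_nonneg ht.1 fun s _ => hP0 s
  -- Since Q' = w ≤ D + Q, the integrating factor exp(-t) makes this product nonincreasing.
  have hgr := hanti (fun t => Real.exp (-t) * (Q t + D)) _
    (fun t => ((hasDerivAt_neg t).exp).mul ((hQd t).add_const D)) (fun t ht => by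
      have h1 := hmain t ht
      have h2 : 0 ≤ 4 * κ / r * R t := mul_nonneg (by positivity) (hRnn t ht)
      have h3 := Real.exp_pos (-t)
      nlinarith) T (right_mem_Icc.2 hT)
  simp only [neg_zero, Real.exp_zero, hQ0, zero_add, one_mul] at hgr
  have hexp : Q T + D ≤ D * Real.exp T := by
    have := mul_le_mul_of_nonneg_right hgr (Real.exp_pos T).le
    rwa [mul_right_comm, ← Real.exp_add, neg_add_cancel, Real.exp_zero, one_mul] at this
  refine ⟨by change Q T ≤ D * (Real.exp T - 1); linarith, ?_⟩
  change R T ≤ r / (4 * κ) * (D * Real.exp T)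
  have h1 := hmain T (right_mem_Icc.2 hT)
  have hwT : 0 ≤ w T := by
    have := hjw T
    by_contra hneg
    nlinarith [sq_nonneg (j T), not_le.1 hneg]
  have h2 : r / (4 * κ) * (4 * κ / r * R T) ≤ r / (4 * κ) * (D * Real.exp T) :=
    mul_le_mul_of_nonneg_left (by linarith) (by positivity)
  have e : r / (4 * κ) * (4 * κ / r * R T) = R T := by field_simp
  linarith

/-! ### The mollified beam equation -/

/-- Test the definition of ut with ψ(x) η(t - s). No initial term appears because the time tests may
be nonzero at 0, which encodes u(·, 0) = 0. -/
theorem ae_tconv_deriv_eq {ℓ T : ℝ} {u ut : ℝ → ℝ → ℝ} (hu : MemL2Omega ℓ T u)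
    (hut : MemL2Omega ℓ T ut)
    (hd : ∀ ψ φ : ℝ → ℝ, ContDiff ℝ ∞ ψ → HasCompactSupport ψ → tsupport ψ ⊆ Ioo 0 ℓ →
      IsTimeTest T φ → ∫ p in Omega ℓ T, u p.1 p.2 * (ψ p.1 * deriv φ p.2) =
        -∫ p in Omega ℓ T, ut p.1 p.2 * (ψ p.1 * φ p.2))
    {η : ℝ → ℝ} (hη : IsCausalKernel η) {t : ℝ} (ht : t ≤ T) :
    ∀ᵐ x ∂(volume.restrict (Ioo 0 ℓ)), tconv T (deriv η) (u x) t = tconv T η (ut x) t := by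
  refine ae_eq_of_integral_mul_test_eq
    (MemL2.integrableOn (hu.memL2_tconv hη.deriv t)).locallyIntegrableOn
    (MemL2.integrableOn (hut.memL2_tconv hη t)).locallyIntegrableOn fun ψ hψ hc hs => ?_
  have hψ2 : MemL2 0 ℓ ψ := memL2_of_continuousOn hψ.continuous.continuousOn
  have h := hd ψ _ hψ hc hs (hη.isTimeTest ht)
  simp only [hη.deriv_comp_sub] at h
  have e1 := hu.integral_mul_mul hη.deriv hψ2 t
  have e2 := hut.integral_mul_mul hη hψ2 t
  simp only [mul_comm _ (ψ _)]
  rw [← e1, ← e2]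
  rw [← neg_inj, ← integral_neg]
  calc _ = _ := ?_
    _ = _ := h
    _ = _ := ?_
  · congr 1; ext p; ring
  · congr 2; ext p; ring

theorem primitive_tconv_eq {ℓ T : ℝ} (hℓ : 0 < ℓ) {u ux uxx : ℝ → ℝ → ℝ}
    (hux : MemL2Omega ℓ T ux) (huxx : MemL2Omega ℓ T uxx)
    (hV : ∀ᵐ t ∂(volume.restrict (Ioo 0 T)),
      MemV2 ℓ (fun x => u x t) (fun x => ux x t) (fun x => uxx x t))
    {η : ℝ → ℝ} (hη : IsCausalKernel η) (t : ℝ) {x : ℝ} (hx : x ∈ Icc 0 ℓ) :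
    ∫ y in (0 : ℝ)..x, ∫ z in (0 : ℝ)..y, tconv T η (uxx z) t = tconv T η (u x) t := by
  have h1 : ∀ y ∈ Icc 0 ℓ, ∫ z in (0 : ℝ)..y, tconv T η (uxx z) t = tconv T η (ux y) t := by
    intro y hy
    rw [huxx.integral_primitive_tconv hη hy]
    exact tconv_congr (hV.mono fun s hs => (hs.eq_primitive₁ hℓ hy).symm) t
  rw [intervalIntegral.integral_congr (g := fun y => tconv T η (ux y) t) fun y hy => h1 y ?_,
    hux.integral_primitive_tconv hη hx]
  · exact tconv_congr (hV.mono fun s hs => (hs.eq_primitive hℓ hx).symm) t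
  · rw [uIcc_of_le hx.1] at hy
    exact ⟨hy.1, hy.2.trans hx.2⟩

/-- For φ(s) = η(t - s) one has φ' = -η'(t - s), so the two terms with φ' change sign and become
time derivatives of mollifications; Fubini separates space from time. -/
theorem mollified_equation {ℓ T : ℝ} {ρ μ r κ M g : ℝ → ℝ} {ut uxx : ℝ → ℝ → ℝ}
    (hρ : MemLp ρ ⊤ (volume.restrict (Ioo 0 ℓ))) (hμ : MemLp μ ⊤ (volume.restrict (Ioo 0 ℓ)))
    (hr : MemLp r ⊤ (volume.restrict (Ioo 0 ℓ))) (hκ : MemLp κ ⊤ (volume.restrict (Ioo 0 ℓ)))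
    (hut : MemL2Omega ℓ T ut) (huxx : MemL2Omega ℓ T uxx)
    (hg : IntegrableOn g (Ioo 0 T)) (hM : IntegrableOn M (Ioo 0 T))
    (heq : ∀ v v₁ v₂ φ : ℝ → ℝ, MemV2 ℓ v v₁ v₂ → IsTimeTest T φ →
      ∫ p in Omega ℓ T,
          (-(ρ p.1 * ut p.1 p.2 * v p.1 * deriv φ p.2)
            + μ p.1 * ut p.1 p.2 * v p.1 * φ p.2
            + r p.1 * uxx p.1 p.2 * v₂ p.1 * φ p.2
            - κ p.1 * uxx p.1 p.2 * v₂ p.1 * deriv φ p.2) =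
        ∫ t in Ioo 0 T, (g t * v ℓ + M t * v₁ ℓ) * φ t)
    {η : ℝ → ℝ} (hη : IsCausalKernel η) {t : ℝ} (ht : t ≤ T) {v v₁ v₂ : ℝ → ℝ}
    (hv : MemV2 ℓ v v₁ v₂) :
    (∫ x in Ioo 0 ℓ, ρ x * v x * tconv T (deriv η) (ut x) t)
      + (∫ x in Ioo 0 ℓ, μ x * v x * tconv T η (ut x) t)
      + (∫ x in Ioo 0 ℓ, r x * v₂ x * tconv T η (uxx x) t)
      + (∫ x in Ioo 0 ℓ, κ x * v₂ x * tconv T (deriv η) (uxx x) t) =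
    tconv T η g t * v ℓ + tconv T η M t * v₁ ℓ := by
  have hv2 : MemL2 0 ℓ v := memL2_of_continuousOn hv.cont
  have a1 : MemL2 0 ℓ (fun x => ρ x * v x) := MemLp.mul hv2 hρ
  have a2 : MemL2 0 ℓ (fun x => μ x * v x) := MemLp.mul hv2 hμ
  have a3 : MemL2 0 ℓ (fun x => r x * v₂ x) := MemLp.mul hv.memL2 hr
  have a4 : MemL2 0 ℓ (fun x => κ x * v₂ x) := MemLp.mul hv.memL2 hκ
  have h := heq v v₁ v₂ _ hv (hη.isTimeTest ht)
  simp only [hη.deriv_comp_sub] at h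
  have i1 := hut.integrable_mul_mul hη.deriv a1 t
  have i2 := hut.integrable_mul_mul hη a2 t
  have i3 := huxx.integrable_mul_mul hη a3 t
  have i4 := huxx.integrable_mul_mul hη.deriv a4 t
  rw [← hut.integral_mul_mul hη.deriv a1, ← hut.integral_mul_mul hη a2,
    ← huxx.integral_mul_mul hη a3, ← huxx.integral_mul_mul hη.deriv a4]
  simp only [MemL2Omega.restrict_Omega] at h ⊢
  rw [← integral_add' i1 i2, ← integral_add' (i1.add i2) i3,
    ← integral_add' ((i1.add i2).add i3) i4]
  calc _ = _ := ?_
    _ = _ := h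
    _ = _ := ?_
  · congr 1; ext p; simp only [Pi.add_apply]; ring
  · have j1 := (hη.integrable_mul hg t).mul_const (v ℓ)
    have j2 := (hη.integrable_mul hM t).mul_const (v₁ ℓ)
    unfold tconv
    rw [← integral_mul_const, ← integral_mul_const, ← integral_add j1 j2]
    congr 1; ext s; ring

/-- The rigorous form of testing with u_t. The kernel is not normalised here: the bound involves g
only through η' * g. -/
theorem tip_estimate {ℓ T r₀ κ₀ c : ℝ} (hℓ : 0 < ℓ) (hT : 0 < T) (hr₀ : 0 < r₀) (hκ₀ : 0 < κ₀)
    {ρ₀ ρ₁ μ₀ μ₁ r₁ κ₁ : ℝ} (hρ₀ : 0 ≤ ρ₀) (hμ₀ : 0 ≤ μ₀) {ρ μ r κ g : ℝ → ℝ}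
    (hρ : IsCoeff ℓ ρ₀ ρ₁ ρ) (hμ : IsCoeff ℓ μ₀ μ₁ μ)
    (hr : IsCoeff ℓ r₀ r₁ r) (hκ : IsCoeff ℓ κ₀ κ₁ κ) (hg : IntegrableOn g (Ioo 0 T))
    {u : ℝ → ℝ → ℝ} (hu : IsWeakSolution ℓ T ρ μ r κ (fun t => c * g t) g u)
    {η : ℝ → ℝ} (hη : IsCausalKernel η) :
    ∫ t in Ioo 0 T, tconv T η (u ℓ) t ^ 2 ≤ ℓ ^ 3 / 3 *
        (4 * (ellHat ℓ * (1 + c ^ 2)) * (1 + T) / r₀ ^ 2 *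
          (∫ t in Ioo 0 T, tconv T (deriv η) g t ^ 2) * (Real.exp T - 1)) ∧
    ∫ t in Ioo 0 T, tconv T (deriv η) (u ℓ) t ^ 2 ≤ ℓ ^ 3 / 3 *
      (r₀ / (4 * κ₀) * (4 * (ellHat ℓ * (1 + c ^ 2)) * (1 + T) / r₀ ^ 2 *
        (∫ t in Ioo 0 T, tconv T (deriv η) g t ^ 2) * Real.exp T)) := by
  obtain ⟨ux, uxx, ut, hu0, hux, huxx, hV, hut, hd, heq⟩ := hu
  have hη' := hη.deriv
  have hone : MemLp (fun _ : ℝ => (1 : ℝ)) ⊤ (volume.restrict (Ioo 0 ℓ)) := memLp_const 1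
  have hone2 : MemL2 0 ℓ (fun _ => 1) := memLp_const 1
  have hlin : MemL2 0 ℓ (fun x => ℓ - x) := memL2_of_continuousOn (by fun_prop)
  have hell : 0 < ellHat ℓ := by unfold ellHat; positivity
  -- tip displacement and slope of the mollified solution
  have hslope_int : IntegrableOn (fun s => ∫ x in Ioo 0 ℓ, 1 * uxx x s) (Ioo 0 T) :=
    (huxx.memL2_integral_mul hone2).integrableOn
  have htip_int : IntegrableOn (fun s => ∫ x in Ioo 0 ℓ, (ℓ - x) * uxx x s) (Ioo 0 T) :=
    (huxx.memL2_integral_mul hlin).integrableOn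
  set z : ℝ → ℝ := fun s => ∫ x in Ioo 0 ℓ, 1 * uxx x s with hz
  set y : ℝ → ℝ := fun s => ∫ x in Ioo 0 ℓ, (ℓ - x) * uxx x s with hy
  -- The tip trace is replaced by an integral functional of `uxx`, equal to it for almost every
  -- time; convolutions do not see the difference.
  have hyu : ∀ᵐ s ∂(volume.restrict (Ioo 0 T)), u ℓ s = y s :=
    hV.mono fun s hs => hs.tip_displacement hℓ
  have htip : ∀ θ, IsCausalKernel θ → ∀ t,
      tconv T θ y t ^ 2 ≤ ℓ ^ 3 / 3 * ∫ x in Ioo 0 ℓ, 1 * tconv T θ (uxx x) t ^ 2 := by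
    intro θ hθ t
    have e : ∫ x in Ioo 0 ℓ, (ℓ - x) ^ 2 = ℓ ^ 3 / 3 := by
      rw [← integral_Ioc_eq_integral_Ioo, ← intervalIntegral.integral_of_le hℓ.le,
        intervalIntegral.integral_comp_sub_left (fun x => x ^ 2) ℓ]
      simp; norm_num
    rw [← huxx.integral_mul_tconv hθ hlin, ← e]
    simpa only [one_mul] using sq_integral_mul_le hlin (huxx.memL2_tconv hθ t)
  have hslope : ∀ t, tconv T η z t ^ 2 ≤ ℓ * ∫ x in Ioo 0 ℓ, 1 * tconv T η (uxx x) t ^ 2 := by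
    intro t
    have e : ∫ x in Ioo 0 ℓ, (1 : ℝ) ^ 2 = ℓ := by simp [hℓ.le]
    rw [← huxx.integral_mul_tconv hη hone2]
    have := sq_integral_mul_le hone2 (huxx.memL2_tconv hη t)
    rw [e] at this
    simpa only [one_mul] using this
  have hE := fun t => ((hut.hasDerivAt_integral_tconv_sq hη hρ.1 t).add
    (huxx.hasDerivAt_integral_tconv_sq hη hr.1 t)).const_mul (1 / 2)
  have hcongr : ∀ θ t, tconv T θ (u ℓ) t = tconv T θ y t := fun θ t => tconv_congr hyu t
  have hdiss : ∀ t ∈ Icc 0 T, 1 / 2 *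
      ((∫ x in Ioo 0 ℓ, ρ x * (2 * tconv T η (ut x) t * tconv T (deriv η) (ut x) t)) +
        ∫ x in Ioo 0 ℓ, r x * (2 * tconv T η (uxx x) t * tconv T (deriv η) (uxx x) t)) ≤
      -κ₀ * (∫ x in Ioo 0 ℓ, 1 * tconv T (deriv η) (uxx x) t ^ 2) +
        tconv T η g t * (tconv T (deriv η) y t + c * tconv T (deriv η) z t) := by
    intro t ht
    -- The test function is the time derivative of the mollified solution, built as a double
    -- primitive of η' * uxx; by `hvu` it equals η * ut almost everywhere.
    have hv := memV2_primitive hℓ.le (huxx.memL2_tconv hη' t)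
    have key := mollified_equation hρ.1 hμ.1 hr.1 hκ.1 hut huxx hg (hg.const_mul c) heq hη ht.2 hv
    have hvu : ∀ᵐ x ∂(volume.restrict (Ioo 0 ℓ)),
        ∫ y in (0 : ℝ)..x, ∫ z in (0 : ℝ)..y, tconv T (deriv η) (uxx z) t =
          tconv T η (ut x) t := by
      filter_upwards [ae_tconv_deriv_eq hu0 hut hd hη ht.2, ae_restrict_mem measurableSet_Ioo]
        with x hx hx'
      rw [← hx, primitive_tconv_eq hℓ hux huxx hV hη' t (Ioo_subset_Icc_self hx')]
    have eℓ : ∫ y in (0 : ℝ)..ℓ, ∫ z in (0 : ℝ)..y, tconv T (deriv η) (uxx z) t =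
        tconv T (deriv η) y t := by
      rw [hv.tip_displacement hℓ, huxx.integral_mul_tconv hη' hlin]
    have eℓ₁ : ∫ y in (0 : ℝ)..ℓ, tconv T (deriv η) (uxx y) t = tconv T (deriv η) z t := by
      rw [hv.tip_slope hℓ, huxx.integral_mul_tconv hη' hone2]
    have eM : tconv T η (fun t => c * g t) t = c * tconv T η g t := by
      unfold tconv
      rw [← integral_const_mul]
      congr 1; ext s; ring
    have k1 : ∫ x in Ioo 0 ℓ, ρ x * (2 * tconv T η (ut x) t * tconv T (deriv η) (ut x) t) =
        2 * ∫ x in Ioo 0 ℓ, ρ x * (∫ y in (0 : ℝ)..x, ∫ z in (0 : ℝ)..y,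
          tconv T (deriv η) (uxx z) t) * tconv T (deriv η) (ut x) t := by
      rw [← integral_const_mul]
      refine integral_congr_ae (hvu.mono fun x hx => ?_)
      simp only [hx]; ring
    have k2 : ∫ x in Ioo 0 ℓ, μ x * (∫ y in (0 : ℝ)..x, ∫ z in (0 : ℝ)..y,
          tconv T (deriv η) (uxx z) t) * tconv T η (ut x) t =
        ∫ x in Ioo 0 ℓ, μ x * tconv T η (ut x) t ^ 2 := by
      refine integral_congr_ae (hvu.mono fun x hx => ?_)
      simp only [hx]; ring
    have k3 : ∫ x in Ioo 0 ℓ, r x * (2 * tconv T η (uxx x) t * tconv T (deriv η) (uxx x) t) =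
        2 * ∫ x in Ioo 0 ℓ, r x * tconv T (deriv η) (uxx x) t * tconv T η (uxx x) t := by
      rw [← integral_const_mul]
      congr 1; ext x; ring
    have k4 : ∫ x in Ioo 0 ℓ, κ x * tconv T (deriv η) (uxx x) t * tconv T (deriv η) (uxx x) t =
        ∫ x in Ioo 0 ℓ, κ x * tconv T (deriv η) (uxx x) t ^ 2 := by
      congr 1; ext x; ring
    have p1 := hμ.mul_integral_sq_le (hut.memL2_tconv hη t)
    have p2 := hκ.mul_integral_sq_le (huxx.memL2_tconv hη' t)
    have p3 : 0 ≤ μ₀ * ∫ x in Ioo 0 ℓ, tconv T η (ut x) t ^ 2 :=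
      mul_nonneg hμ₀ (integral_nonneg fun x => sq_nonneg _)
    rw [eℓ, eℓ₁, eM, k2, k4] at key
    rw [k1, k3]
    simp only [one_mul]
    linarith
  -- Here j = y + c z, and j² ≤ (1 + c²)(y² + z²). Cauchy-Schwarz bounds y² by ℓ³/3 · w and z² by ℓ
  -- · w, which sum to `ellHat ℓ` · w; hence this K.
  have main := gronwall_of_energy_inequality (K := ellHat ℓ * (1 + c ^ 2)) hT.le hr₀ hκ₀
    (by positivity) hE (fun t => hη.hasDerivAt_tconv hg t)
    (fun t => (hη.hasDerivAt_tconv htip_int t).add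
      ((hη.hasDerivAt_tconv hslope_int t).const_mul c))
    (huxx.continuous_integral_tconv_sq hη hone) (huxx.continuous_integral_tconv_sq hη' hone)
    (hη'.continuous_tconv hg)
    (fun t => integral_nonneg fun x => by simp only [one_mul]; positivity)
    (by simp [hη.tconv_eq_zero le_rfl]) (hη.tconv_eq_zero le_rfl) hdiss
    (fun t => by
      have q1 := hρ.mul_integral_sq_le (hut.memL2_tconv hη t)
      have q2 := hr.mul_integral_sq_le (huxx.memL2_tconv hη t)
      have q3 : 0 ≤ ρ₀ * ∫ x in Ioo 0 ℓ, tconv T η (ut x) t ^ 2 :=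
        mul_nonneg hρ₀ (integral_nonneg fun x => sq_nonneg _)
      simp only [one_mul, Pi.add_apply]
      linarith)
    (fun t => by
      have q1 := htip η hη t
      have q2 := hslope t
      have q3 : (tconv T η y t + c * tconv T η z t) ^ 2 ≤
          (1 + c ^ 2) * (tconv T η y t ^ 2 + tconv T η z t ^ 2) := by
        nlinarith [sq_nonneg (c * tconv T η y t - tconv T η z t)]
      refine q3.trans ?_
      rw [mul_comm (ellHat ℓ), mul_assoc]
      refine mul_le_mul_of_nonneg_left ?_ (by positivity)
      rw [ellHat, add_mul]
      linarith)
  have hIoo : ∀ f : ℝ → ℝ, ∫ t in (0 : ℝ)..T, f t = ∫ t in Ioo 0 T, f t := fun f => by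
    rw [intervalIntegral.integral_of_le hT.le, integral_Ioc_eq_integral_Ioo]
  have hint : ∀ θ, IsCausalKernel θ → ∫ t in Ioo 0 T, tconv T θ (u ℓ) t ^ 2 ≤ ℓ ^ 3 / 3 *
      ∫ t in (0 : ℝ)..T, ∫ x in Ioo 0 ℓ, 1 * tconv T θ (uxx x) t ^ 2 := by
    intro θ hθ
    simp only [hcongr]
    rw [← hIoo, ← intervalIntegral.integral_const_mul]
    exact intervalIntegral.integral_mono hT.le
      (((hθ.continuous_tconv htip_int).pow 2).intervalIntegrable _ _)
      (((huxx.continuous_integral_tconv_sq hθ hone).const_mul _).intervalIntegrable _ _)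
      (htip θ hθ)
  simp only [← hIoo] at hint ⊢
  exact ⟨(hint η hη).trans (mul_le_mul_of_nonneg_left main.1 (by positivity)),
    (hint _ hη').trans (mul_le_mul_of_nonneg_left main.2 (by positivity))⟩

/-! ### Properties of the mollification -/

namespace IsCausalKernel

variable {η : ℝ → ℝ} {T : ℝ} {f φ : ℝ → ℝ}

/-- Both boundary terms vanish: at s = 0 because g(0) = 0, at s = T because the kernel is causal and
t ≤ T. -/
theorem tconv_deriv_eq (hη : IsCausalKernel η) (hT : 0 < T) {g g' : ℝ → ℝ}
    (hg : HasWeakDerivOn 0 T g g') (hgc : ContinuousOn g (Icc 0 T)) (hg0 : g 0 = 0)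
    (hg' : IntegrableOn g' (Ioo 0 T)) {t : ℝ} (ht : t ≤ T) :
    tconv T (_root_.deriv η) g t = tconv T η g' t := by
  have hφ := hη.isTimeTest ht
  have h := integral_primitive_mul_deriv hT.le hg' (φ := fun s => η (t - s))
    (hφ.smooth.of_le (by exact_mod_cast le_top)) (hη.eq_zero_of_nonpos (by linarith))
  simp only [hη.deriv_comp_sub, mul_neg, integral_neg, neg_inj] at h
  unfold tconv
  calc _ = ∫ x in Ioo 0 T, (∫ s in (0 : ℝ)..x, g' s) * _root_.deriv η (t - x) :=
        setIntegral_congr_fun measurableSet_Ioo fun x hx => by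
          rw [hg.eq_add_primitive hT hgc hg' (Ioo_subset_Icc_self hx), hg0, zero_add, mul_comm]
    _ = _ := h
    _ = _ := by congr 1; ext s; ring

theorem integrable_prod_mul (hη : IsCausalKernel η) (hf : IntegrableOn f (Ioo 0 T))
    (hφ : Continuous φ) (hc : HasCompactSupport φ) :
    Integrable (fun p : ℝ × ℝ => η (p.1 - p.2) * f p.2 * φ p.1)
      ((volume.restrict (Ioo 0 T)).prod (volume.restrict (Ioo 0 T))) := by
  obtain ⟨C, -, hC⟩ := hη.exists_bound
  obtain ⟨C', hC'⟩ := hc.exists_bound_of_continuous hφ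
  refine Integrable.mul_bdd (c := C') ?_ (hφ.comp continuous_fst).aestronglyMeasurable
    (Filter.Eventually.of_forall fun p => hC' _)
  exact (Integrable.comp_snd hf (volume.restrict (Ioo 0 T))).bdd_mul (c := C)
    (hη.smooth.continuous.comp (by fun_prop)).aestronglyMeasurable
    (Filter.Eventually.of_forall fun p => hC _)

theorem integrable_comp_sub (hη : IsCausalKernel η) (s : ℝ) : Integrable (fun t => η (t - s)) :=
  (hη.smooth.continuous.integrable_of_hasCompactSupport hη.compact).comp_sub_right s

theorem setIntegral_comp_sub_left_le (hη : IsCausalKernel η) (h0 : ∀ x, 0 ≤ η x) (t : ℝ)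
    (s : Set ℝ) : ∫ x in s, η (t - x) ≤ ∫ x, η x := by
  rw [← integral_sub_left_eq_self η volume t]
  exact setIntegral_le_integral
    ((hη.smooth.continuous.integrable_of_hasCompactSupport hη.compact).comp_sub_left t)
    (Filter.Eventually.of_forall fun x => h0 _)

theorem setIntegral_comp_sub_right_le (hη : IsCausalKernel η) (h0 : ∀ x, 0 ≤ η x) (t : ℝ)
    (s : Set ℝ) : ∫ x in s, η (x - t) ≤ ∫ x, η x := by
  rw [← integral_sub_right_eq_self η t]
  exact setIntegral_le_integral (hη.integrable_comp_sub t)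
    (Filter.Eventually.of_forall fun x => h0 _)

/-- Jensen's inequality, by Cauchy-Schwarz on √η · (√η f); the mass of the kernel over (0, T) is at
most 1. -/
theorem tconv_sq_le (hη : IsCausalKernel η) (h0 : ∀ x, 0 ≤ η x) (h1 : ∫ x, η x = 1)
    (hf : MemL2 0 T f) (t : ℝ) : tconv T η f t ^ 2 ≤ tconv T η (fun s => f s ^ 2) t := by
  obtain ⟨C, hC0, hC⟩ := hη.exists_bound
  have hsc : Continuous (fun s => Real.sqrt (η (t - s))) :=
    (hη.smooth.continuous.comp (by fun_prop)).sqrt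
  have hs2 : MemL2 0 T (fun s => Real.sqrt (η (t - s))) := memL2_of_continuousOn hsc.continuousOn
  have hsf : MemL2 0 T (fun s => Real.sqrt (η (t - s)) * f s) := by
    refine MemLp.of_le_mul (c := Real.sqrt C) hf (hsc.aestronglyMeasurable.mul hf.1)
      (Filter.Eventually.of_forall fun s => ?_)
    rw [norm_mul]
    refine mul_le_mul_of_nonneg_right ?_ (norm_nonneg _)
    rw [Real.norm_of_nonneg (Real.sqrt_nonneg _)]
    exact Real.sqrt_le_sqrt ((le_abs_self _).trans (hC _))
  have cs := sq_integral_mul_le hs2 hsf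
  simp only [mul_pow, Real.sq_sqrt (h0 _), ← mul_assoc, Real.mul_self_sqrt (h0 _)] at cs
  refine cs.trans ?_
  have hle := hη.setIntegral_comp_sub_left_le h0 t (Ioo 0 T)
  rw [h1] at hle
  exact mul_le_of_le_one_left (integral_nonneg fun s => mul_nonneg (h0 _) (sq_nonneg _)) hle

/-- Young's inequality for the mollification in time. -/
theorem integral_tconv_sq_le (hη : IsCausalKernel η) (h0 : ∀ x, 0 ≤ η x) (h1 : ∫ x, η x = 1)
    (hf : MemL2 0 T f) :
    ∫ t in Ioo 0 T, tconv T η f t ^ 2 ≤ ∫ t in Ioo 0 T, f t ^ 2 := by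
  obtain ⟨C, hC0, hC⟩ := hη.exists_bound
  have hF : IntegrableOn (fun s => f s ^ 2) (Ioo 0 T) := MemLp.integrable_sq hf
  have hi : Integrable (fun p : ℝ × ℝ => η (p.1 - p.2) * f p.2 ^ 2)
      ((volume.restrict (Ioo 0 T)).prod (volume.restrict (Ioo 0 T))) :=
    (Integrable.comp_snd hF (volume.restrict (Ioo 0 T))).bdd_mul (c := C)
      (hη.smooth.continuous.comp (by fun_prop)).aestronglyMeasurable
      (Filter.Eventually.of_forall fun p => hC _)
  calc ∫ t in Ioo 0 T, tconv T η f t ^ 2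
      ≤ ∫ t in Ioo 0 T, ∫ s in Ioo 0 T, η (t - s) * f s ^ 2 := by
        refine integral_mono ?_ hi.integral_prod_left fun t => hη.tconv_sq_le h0 h1 hf t
        exact MemL2.integrableOn (memL2_of_continuousOn
          ((hη.continuous_tconv hf.integrableOn).pow 2).continuousOn)
    _ = ∫ s in Ioo 0 T, ∫ t in Ioo 0 T, η (t - s) * f s ^ 2 := integral_integral_swap hi
    _ ≤ ∫ s in Ioo 0 T, f s ^ 2 := by
        refine integral_mono hi.integral_prod_right hF fun s => ?_
        simp only [integral_mul_const]
        have hle := hη.setIntegral_comp_sub_right_le h0 s (Ioo 0 T)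
        rw [h1] at hle
        exact mul_le_of_le_one_left (sq_nonneg _) hle

/-- Fubini moves the convolution onto φ, where it averages φ over shifts in (0, δ); the Lipschitz
bound makes the error at most K δ. The support of φ turns the integral over (0, T) into one over the
line. -/
theorem abs_integral_tconv_mul_sub_le (hη : IsCausalKernel η) (h0 : ∀ x, 0 ≤ η x)
    (h1 : ∫ x, η x = 1) {δ : ℝ} (hδ : tsupport η ⊆ Ioo 0 δ) (hf : IntegrableOn f (Ioo 0 T))
    (hφ : Continuous φ) (hc : HasCompactSupport φ) (hs : tsupport φ ⊆ Ioo 0 T) {K : NNReal}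
    (hK : LipschitzWith K φ) :
    |(∫ t in Ioo 0 T, tconv T η f t * φ t) - ∫ t in Ioo 0 T, f t * φ t| ≤
      K * δ * ∫ t in Ioo 0 T, |f t| := by
  have hi := hη.integrable_prod_mul hf hφ hc
  have hηi : Integrable η := hη.smooth.continuous.integrable_of_hasCompactSupport hη.compact
  have hin : ∀ s, |(∫ t in Ioo 0 T, η (t - s) * φ t) - φ s| ≤ K * δ := by
    intro s
    have e1 : ∫ t in Ioo 0 T, η (t - s) * φ t = ∫ τ, η τ * φ (τ + s) := by
      rw [setIntegral_eq_integral_of_forall_compl_eq_zero,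
        ← integral_sub_right_eq_self (fun τ => η τ * φ (τ + s)) s]
      · simp
      · intro t ht
        rw [image_eq_zero_of_notMem_tsupport fun h => ht (hs h), mul_zero]
    have e2 : φ s = ∫ τ, η τ * φ s := by rw [integral_mul_const, h1, one_mul]
    obtain ⟨C', hC'⟩ := hc.exists_bound_of_continuous hφ
    have i1 : Integrable (fun τ => η τ * φ (τ + s)) :=
      hηi.mul_bdd (c := C') (hφ.comp (by fun_prop)).aestronglyMeasurable
        (Filter.Eventually.of_forall fun p => hC' _)
    rw [e1, e2, ← integral_sub i1 (hηi.mul_const _)]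
    calc _ ≤ ∫ τ, |η τ * φ (τ + s) - η τ * φ s| := abs_integral_le_integral_abs
      _ ≤ ∫ τ, η τ * (K * δ) := by
        refine integral_mono (i1.sub (hηi.mul_const _)).abs (hηi.mul_const _) fun τ => ?_
        simp only [← mul_sub, abs_mul, abs_of_nonneg (h0 τ)]
        by_cases hτ : τ ∈ tsupport η
        · refine mul_le_mul_of_nonneg_left ?_ (h0 τ)
          have hd := hK.dist_le_mul (τ + s) s
          rw [Real.dist_eq, Real.dist_eq, add_sub_cancel_right, abs_of_pos (hδ hτ).1] at hd
          exact hd.trans (mul_le_mul_of_nonneg_left (hδ hτ).2.le K.coe_nonneg)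
        · simp [image_eq_zero_of_notMem_tsupport hτ]
      _ = K * δ := by rw [integral_mul_const, h1, one_mul]
  have eF : ∫ t in Ioo 0 T, tconv T η f t * φ t =
      ∫ s in Ioo 0 T, f s * ∫ t in Ioo 0 T, η (t - s) * φ t := by
    calc _ = ∫ t in Ioo 0 T, ∫ s in Ioo 0 T, η (t - s) * f s * φ t := by
          congr 1; ext t; rw [integral_mul_const]; rfl
      _ = ∫ s in Ioo 0 T, ∫ t in Ioo 0 T, η (t - s) * f s * φ t := integral_integral_swap hi
      _ = _ := by
          congr 1; ext s; rw [← integral_const_mul]; congr 1; ext t; ring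
  have j1 : IntegrableOn (fun s => f s * ∫ t in Ioo 0 T, η (t - s) * φ t) (Ioo 0 T) :=
    hi.integral_prod_right.congr (Filter.Eventually.of_forall fun s => by
      simp only; rw [← integral_const_mul]; congr 1; ext t; ring)
  obtain ⟨C', hC'⟩ := hc.exists_bound_of_continuous hφ
  have j2 : IntegrableOn (fun s => f s * φ s) (Ioo 0 T) :=
    Integrable.mul_bdd (c := C') hf hφ.aestronglyMeasurable
      (Filter.Eventually.of_forall fun p => hC' _)
  rw [eF, ← integral_sub j1 j2, ← integral_const_mul]
  refine abs_integral_le_integral_abs.trans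
    (integral_mono (j1.sub j2).abs (hf.abs.const_mul _) fun s => ?_)
  simp only [← mul_sub, abs_mul]
  rw [mul_comm]
  exact mul_le_mul_of_nonneg_right (hin s) (abs_nonneg _)

theorem integral_tconv_mul_deriv (hη : IsCausalKernel η) (hT : 0 < T)
    (hf : IntegrableOn f (Ioo 0 T)) (hφ : ContDiff ℝ ∞ φ) (hs : tsupport φ ⊆ Ioo 0 T) :
    ∫ t in Ioo 0 T, tconv T η f t * _root_.deriv φ t =
      -∫ t in Ioo 0 T, tconv T (_root_.deriv η) f t * φ t := by
  have hc := hη.deriv.continuous_tconv hf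
  rw [← integral_primitive_mul_deriv hT.le (memL2_of_continuousOn hc.continuousOn).integrableOn
    (hφ.of_le (by exact_mod_cast le_top)) (eq_zero_right_of_tsupport_subset_Ioo hs)]
  congr 1; ext t
  rw [intervalIntegral.integral_eq_sub_of_hasDerivAt (fun s _ => hη.hasDerivAt_tconv hf s)
    (hc.intervalIntegrable _ _), hη.tconv_eq_zero le_rfl, sub_zero]

end IsCausalKernel

/-! ### Weak limits in `L²` -/

theorem integral_mul_eq_inner {α : Type*} [MeasurableSpace α] {m : Measure α} {f g : α → ℝ}
    (hf : MemLp f 2 m) (hg : MemLp g 2 m) :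
    ∫ x, f x * g x ∂m = inner ℝ (hf.toLp f) (hg.toLp g) := by
  rw [L2.inner_def]
  refine integral_congr_ae ?_
  filter_upwards [hf.coeFn_toLp, hg.coeFn_toLp] with x h1 h2
  rw [h1, h2]
  simp [mul_comm]

theorem integral_sq_eq_norm_sq {α : Type*} [MeasurableSpace α] {m : Measure α} (F : Lp ℝ 2 m) :
    ∫ x, F x ^ 2 ∂m = ‖F‖ ^ 2 := by
  rw [← real_inner_self_eq_norm_sq, L2.inner_def]
  congr 1; ext x
  rw [real_inner_self_eq_norm_sq, Real.norm_eq_abs, sq_abs]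

/-- A bounded sequence in `L²` has a weak cluster point, within the same bound. -/
theorem exists_weak_limit {α : Type*} [MeasurableSpace α] {m : Measure α} {f : ℕ → α → ℝ}
    (hf : ∀ n, MemLp (f n) 2 m) {B : ℝ} (hB : ∀ n, ∫ x, f n x ^ 2 ∂m ≤ B) :
    ∃ F : α → ℝ, MemLp F 2 m ∧ ∫ x, F x ^ 2 ∂m ≤ B ∧ ∀ (φ : α → ℝ) (c : ℝ), MemLp φ 2 m →
      Filter.Tendsto (fun n => ∫ x, f n x * φ x ∂m) Filter.atTop (nhds c) →
      ∫ x, F x * φ x ∂m = c := by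
  have hB0 : 0 ≤ B := (integral_nonneg fun x => sq_nonneg _).trans (hB 0)
  let D : ℕ → WeakDual ℝ (Lp ℝ 2 m) := fun n =>
    StrongDual.toWeakDual (InnerProductSpace.toDual ℝ (Lp ℝ 2 m) ((hf n).toLp (f n)))
  have hD : ∀ n, D n ∈ WeakDual.toStrongDual ⁻¹' Metric.closedBall
      (0 : StrongDual ℝ (Lp ℝ 2 m)) (Real.sqrt B) := by
    intro n
    simp only [mem_preimage, mem_closedBall_zero_iff]
    change ‖InnerProductSpace.toDual ℝ (Lp ℝ 2 m) ((hf n).toLp (f n))‖ ≤ _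
    rw [LinearIsometryEquiv.norm_map]
    refine Real.le_sqrt_of_sq_le ?_
    rw [← real_inner_self_eq_norm_sq, ← integral_mul_eq_inner]
    simpa only [sq] using hB n
  -- Banach-Alaoglu along a free ultrafilter: no separability or subsequence is needed, and any
  -- pairing that converges along the sequence has the same limit along the ultrafilter.
  obtain ⟨d, hd, hlim⟩ := (WeakDual.isCompact_closedBall (𝕜 := ℝ)
    (0 : StrongDual ℝ (Lp ℝ 2 m)) (Real.sqrt B)).ultrafilter_le_nhds
    ((Filter.hyperfilter ℕ).map D) (by
      rw [Filter.le_principal_iff]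
      exact Filter.mem_map.2 (Filter.mem_of_superset Filter.univ_mem fun n _ => hD n))
  let F : Lp ℝ 2 m := (InnerProductSpace.toDual ℝ (Lp ℝ 2 m)).symm (WeakDual.toStrongDual d)
  refine ⟨F, Lp.memLp F, ?_, fun φ c hφ hc => ?_⟩
  · rw [integral_sq_eq_norm_sq, LinearIsometryEquiv.norm_map]
    rw [mem_preimage, mem_closedBall_zero_iff] at hd
    calc _ ≤ Real.sqrt B ^ 2 := pow_le_pow_left₀ (norm_nonneg _) hd 2
      _ = B := Real.sq_sqrt hB0
  · have h1 : Filter.Tendsto (fun n => D n (hφ.toLp φ)) (Filter.hyperfilter ℕ)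
        (nhds (d (hφ.toLp φ))) :=
      ((WeakDual.eval_continuous (hφ.toLp φ)).tendsto d).comp hlim
    have h2 : Filter.Tendsto (fun n => D n (hφ.toLp φ)) (Filter.hyperfilter ℕ) (nhds c) := by
      refine (hc.congr fun n => ?_).mono_left
        (Filter.hyperfilter_le_cofinite.trans Nat.cofinite_eq_atTop.le)
      rw [integral_mul_eq_inner (hf n) hφ]
      rfl
    rw [← tendsto_nhds_unique h1 h2, integral_mul_eq_inner (Lp.memLp F) hφ, Lp.toLp_coeFn]
    exact InnerProductSpace.toDual_symm_apply

/-! ### Removing the mollification -/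

theorem tendsto_integral_tconv_mul {T : ℝ} {η : ℕ → ℝ → ℝ} (hη : ∀ n, IsCausalKernel (η n))
    (h0 : ∀ n x, 0 ≤ η n x) (h1 : ∀ n, ∫ x, η n x = 1)
    (hs : ∀ n : ℕ, tsupport (η n) ⊆ Ioo 0 (1 / ((n : ℝ) + 1))) {f φ : ℝ → ℝ}
    (hf : IntegrableOn f (Ioo 0 T)) (hφ : ContDiff ℝ ∞ φ) (hc : HasCompactSupport φ)
    (hφs : tsupport φ ⊆ Ioo 0 T) :
    Filter.Tendsto (fun n => ∫ t in Ioo 0 T, tconv T (η n) f t * φ t) Filter.atTop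
      (nhds (∫ t in Ioo 0 T, f t * φ t)) := by
  obtain ⟨K, hK⟩ :=
    (hφ.of_le (m := 1) (by exact_mod_cast le_top)).lipschitzWith_of_hasCompactSupport hc
    one_ne_zero
  rw [tendsto_iff_norm_sub_tendsto_zero]
  refine squeeze_zero (fun n => norm_nonneg _) (fun n =>
    (hη n).abs_integral_tconv_mul_sub_le (h0 n) (h1 n) (hs n) hf hφ.continuous hc hφs hK) ?_
  have := (tendsto_one_div_add_atTop_nhds_zero_nat (𝕜 := ℝ)).const_mul (K : ℝ)
  simpa using this.mul_const (∫ t in Ioo 0 T, |f t|)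

/-- If the causal mollifications of `f` are bounded in `H¹(0, T)`, then `f` is in `H¹(0, T)`. -/
theorem memH1_of_tconv_bounded {T B₀ B₁ : ℝ} (hT : 0 < T) {f : ℝ → ℝ} (hf : MemL2 0 T f)
    (hB₀ : ∀ η : ℝ → ℝ, IsCausalKernel η → (∀ x, 0 ≤ η x) → ∫ x, η x = 1 →
      ∫ t in Ioo 0 T, tconv T η f t ^ 2 ≤ B₀)
    (hB₁ : ∀ η : ℝ → ℝ, IsCausalKernel η → (∀ x, 0 ≤ η x) → ∫ x, η x = 1 →
      ∫ t in Ioo 0 T, tconv T (deriv η) f t ^ 2 ≤ B₁) :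
    MemH1 0 T f ∧ h1NormSq 0 T f ≤ B₀ + B₁ := by
  have hex : ∀ n : ℕ, ∃ η : ℝ → ℝ, IsCausalKernel η ∧ (∀ x, 0 ≤ η x) ∧ ∫ x, η x = 1 ∧
      tsupport η ⊆ Ioo 0 (1 / ((n : ℝ) + 1)) := by
    intro n
    obtain ⟨η, h1, h2, h3, h4, h5⟩ :=
      exists_test_integral_eq_one (a := 0) (b := 1 / ((n : ℝ) + 1)) (by positivity)
    exact ⟨η, ⟨h1, h2, h3.trans Ioo_subset_Ioi_self⟩, h4, h5, h3⟩
  choose η hη h0 h1 hs using hex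
  have hfi := hf.integrableOn
  have hmem : ∀ θ, IsCausalKernel θ → MemL2 0 T (tconv T θ f) := fun θ hθ =>
    memL2_of_continuousOn (hθ.continuous_tconv hfi).continuousOn
  obtain ⟨F, hF, hFB, hFlim⟩ := exists_weak_limit (fun n => hmem (η n) (hη n))
    (fun n => hB₀ (η n) (hη n) (h0 n) (h1 n))
  obtain ⟨F₁, hF₁, hFB₁, hFlim₁⟩ := exists_weak_limit (fun n => hmem _ (hη n).deriv)
    (fun n => hB₁ (η n) (hη n) (h0 n) (h1 n))
  have htest : ∀ φ : ℝ → ℝ, ContDiff ℝ ∞ φ → MemL2 0 T φ := fun φ hφ =>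
    memL2_of_continuousOn hφ.continuous.continuousOn
  have hFf : ∀ᵐ x ∂(volume.restrict (Ioo 0 T)), F x = f x :=
    ae_eq_of_integral_mul_test_eq (MemL2.integrableOn hF).locallyIntegrableOn
      hfi.locallyIntegrableOn fun φ hφ hc hφs =>
        hFlim φ _ (htest φ hφ) (tendsto_integral_tconv_mul hη h0 h1 hs hfi hφ hc hφs)
  have hweak : HasWeakDerivOn 0 T f F₁ :=
    { locInt := hfi.locallyIntegrableOn
      locInt' := (MemL2.integrableOn hF₁).locallyIntegrableOn
      integral_eq := fun φ hφ hc hφs => by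
        -- The pairings of η' * f with φ are minus those of η * f with φ', so they tend to -∫ f φ';
        -- this identifies the weak limit F₁ as the weak derivative of f.
        have h := (tendsto_integral_tconv_mul hη h0 h1 hs hfi
          (contDiff_infty_iff_deriv.1 hφ).2 hc.deriv
          ((tsupport_deriv_subset (𝕜 := ℝ)).trans hφs)).neg
        simp only [(hη _).integral_tconv_mul_deriv hT hfi hφ hφs, neg_neg] at h
        rw [hFlim₁ φ _ (htest φ hφ) h, neg_neg] }
  refine ⟨⟨hf, F₁, hF₁, hweak⟩, ?_⟩
  rw [h1NormSq, hweak.l2NormSq_weakDeriv]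
  refine add_le_add (le_of_eq_of_le ?_ hFB) hFB₁
  exact integral_congr_ae (hFf.mono fun x hx => by simp only [hx])

theorem IsWeakSolution.memL2_tip {ℓ T : ℝ} (hℓ : 0 < ℓ) {ρ μ r κ M g : ℝ → ℝ} {u : ℝ → ℝ → ℝ}
    (hu : IsWeakSolution ℓ T ρ μ r κ M g u) : MemL2 0 T (u ℓ) := by
  obtain ⟨ux, uxx, ut, -, -, huxx, hV, -⟩ := hu
  have hlin : MemL2 0 ℓ (fun x => ℓ - x) := memL2_of_continuousOn (by fun_prop)
  exact (memLp_congr_ae (hV.mono fun s hs => hs.tip_displacement hℓ)).2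
    (huxx.memL2_integral_mul hlin)

end AFMBeam

/-! ### Conclusion and constants -/

theorem corollary1
    (ℓ T h θ : ℝ) (hℓ : 0 < ℓ) (hT : 0 < T) (hh : 0 < h) (hθ : 0 < θ)
    (ρ₀ ρ₁ μ₀ μ₁ r₀ r₁ κ₀ κ₁ : ℝ)
    (hρ₀ : 0 < ρ₀) (hμ₀ : 0 ≤ μ₀) (hr₀ : 0 < r₀) (hκ₀ : 0 < κ₀)
    (ρ μ r κ : ℝ → ℝ)
    (hρ : AFMBeam.IsCoeff ℓ ρ₀ ρ₁ ρ) (hμ : AFMBeam.IsCoeff ℓ μ₀ μ₁ μ)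
    (hr : AFMBeam.IsCoeff ℓ r₀ r₁ r) (hκ : AFMBeam.IsCoeff ℓ κ₀ κ₁ κ)
    (g : ℝ → ℝ) (hg : AFMBeam.MemH1 0 T g) (hgc : ContinuousOn g (Icc 0 T)) (hg0 : g 0 = 0)
    (u : ℝ → ℝ → ℝ)
    (hu : AFMBeam.IsWeakSolution ℓ T ρ μ r κ
      (fun t => 2 * h * Real.cos θ / Real.pi * g t) g u) :
    AFMBeam.MemH1 0 T (fun t => u ℓ t) ∧
    AFMBeam.h1NormSq 0 T (fun t => u ℓ t) ≤
      AFMBeam.C3Sq ℓ T h θ r₀ κ₀ * AFMBeam.l2NormSq 0 T (AFMBeam.weakDeriv 0 T g) := by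
  obtain ⟨hg2, g', hg'2, hg'⟩ := hg
  rw [hg'.l2NormSq_weakDeriv]
  set c := 2 * h * Real.cos θ / Real.pi with hc
  set N := AFMBeam.l2NormSq 0 T g' with hN
  have hN0 : 0 ≤ N := integral_nonneg fun x => sq_nonneg _
  set A := 4 * (AFMBeam.ellHat ℓ * (1 + c ^ 2)) * (1 + T) / r₀ ^ 2 with hA
  have hA0 : 0 ≤ A := by
    have : 0 < AFMBeam.ellHat ℓ := by unfold AFMBeam.ellHat; positivity
    positivity
  have hexp : 0 ≤ Real.exp T - 1 := by linarith [Real.add_one_le_exp T]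
  have hyoung : ∀ η : ℝ → ℝ, AFMBeam.IsCausalKernel η → (∀ x, 0 ≤ η x) → ∫ x, η x = 1 →
      ∫ t in Ioo 0 T, AFMBeam.tconv T (deriv η) g t ^ 2 ≤ N := by
    intro η hη h0 h1
    refine le_of_eq_of_le ?_ (hη.integral_tconv_sq_le h0 h1 hg'2)
    exact setIntegral_congr_fun measurableSet_Ioo fun t ht => by
      simp only [hη.tconv_deriv_eq hT hg' hgc hg0 (AFMBeam.MemL2.integrableOn hg'2)
        (mem_Ioo.1 ht).2.le]
  have htip := fun (η : ℝ → ℝ) (hη : AFMBeam.IsCausalKernel η) =>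
    AFMBeam.tip_estimate hℓ hT hr₀ hκ₀ hρ₀.le hμ₀ hρ hμ hr hκ hg2.integrableOn hu hη
  have main := AFMBeam.memH1_of_tconv_bounded hT (hu.memL2_tip hℓ)
    (B₀ := ℓ ^ 3 / 3 * (A * N * (Real.exp T - 1)))
    (B₁ := ℓ ^ 3 / 3 * (r₀ / (4 * κ₀) * (A * N * Real.exp T)))
    (fun η hη h0 h1 => (htip η hη).1.trans (by gcongr; exact hyoung η hη h0 h1))
    (fun η hη h0 h1 => (htip η hη).2.trans (by gcongr; exact hyoung η hη h0 h1))
  refine ⟨main.1, main.2.trans ?_⟩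
  have hC0 : AFMBeam.C0Sq ℓ T r₀ * (1 + AFMBeam.CthetaSq h θ) = A := by
    rw [AFMBeam.C0Sq, AFMBeam.CthetaSq, hA, hc]; ring
  have hAN : 0 ≤ A * N := mul_nonneg hA0 hN0
  rw [AFMBeam.C3Sq, AFMBeam.C1Sq, AFMBeam.C2Sq, AFMBeam.CeSq, hC0]
  -- The energy argument gives exp T - 1 and exp T; the stated constants have exp T and 1 + exp T,
  -- so there is slack in both terms.
  calc ℓ ^ 3 / 3 * (A * N * (Real.exp T - 1)) +
        ℓ ^ 3 / 3 * (r₀ / (4 * κ₀) * (A * N * Real.exp T))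
      ≤ ℓ ^ 3 / 3 * (A * N * Real.exp T) +
        ℓ ^ 3 / 3 * (r₀ / (4 * κ₀) * (A * N * (1 + Real.exp T))) := by
        gcongr <;> linarith
    _ = _ := by ring
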